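/- **Fully-discrete energy stability.** Let $d\ge 1$, let $\Omega\subset\mathbb R^d$ be an open set with $\Omega=\operatorname{int}\overline\Omega$, and let $\mathcal T$ be a conforming triangulation of $\overline\Omega$ by finitely many open $d$-simplices (two closed simplices meet in a common, possibly empty, sub-simplex). Let $\mathcal E$ be the set of interfaces (facets shared by two simplices) and let boundary facets be those contained in $\partial\Omega$. For $k\in\mathbb N$ let $V_h$ be the space of functions that are polynomials of degree $\le k$ on each $T\in\mathcal T$; let $V_{h,0}\subset V_h$ be the functions with zero trace on $\partial\Omega$, $V_{h,\mathbf n}\subset (V_h)^d$ the fields with zero normal trace on $\partial\Omega$, and $\mathcal V_h=V_h\times (V_{h,0})^d\times V_h\times V_h\times V_h\times V_{h,\mathbf n}$. All derivatives are taken elementwise. On an interface of $T_1,T_2$, with outward unit normals $\mathbf n_{T_i}$, put $\{g\}=\frac12(g|_{T_1}+g|_{T_2})$, $[\Phi]=\sum_i\Phi|_{T_i}\mathbf n_{T_i}$, $[\mathbf u]=\sum_i\mathbf u|_{T_i}\cdot\mathbf n_{T_i}$, $[\mathbf u]_\otimes=\sum_i\mathbf u|_{T_i}\otimes\mathbf n_{T_i}$;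 on a boundary facet only the one adjacent simplex contributes and $\{g\}=g|_T$. Let $\tilde f:\mathbb R^2\to\mathbb R$, $F(\rho,\varphi)=\rho\tilde f(\rho,\varphi)$, let $\gamma,\eta,\alpha_B$ be real constants, and let $\mathbf S(\nabla\mathbf v,\varphi)=\nu_1(\varphi)(\nabla\mathbf v+\nabla\mathbf v^{\top})+\nu_2(\varphi)\operatorname{div}\mathbf v\, I$ with functions $\nu_1,\nu_2:\mathbb R\to\mathbb R$. Define $$B_h[\varphi;\mathbf v,\mathbf X]=\int_\Omega\mathbf S(\nabla\mathbf v,\varphi):\nabla\mathbf X\,dx-\int_{\mathcal E\cup\partial\Omega}\{\mathbf S(\nabla\mathbf v,\varphi)\}:[\mathbf X]_\otimes+\{\mathbf S(\nabla\mathbf X,\varphi)\}:[\mathbf v]_\otimes\,ds+\int_{\mathcal E\cup\partial\Omega}\frac{\alpha_B}{|e|}[\mathbf v]_\otimes:[\mathbf X]_\otimes\,ds .$$ Let $0=t_0<\dots<t_N=t_{\rm end}$, $\Delta t_n=t_{n+1}-t_n$, let $(\rho_0,\mathbf v_0,\varphi_0,\mu_0,\tau_0,\boldsymbol\sigma_0)$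 be initial functions in $L^2(\Omega)$, and write $g^n=g(t_n)$, $g^{n+\frac12}=\frac12(g^n+g^{n+1})$. A *fully discrete dG approximation* is a function $U_h=(\rho_h,\mathbf v_h,\varphi_h,\mu_h,\tau_h,\boldsymbol\sigma_h):[0,t_{\rm end}]\to\mathcal V_h$ that is affine on every $[t_n,t_{n+1}]$, whose initial value $U_h(0)$ is the $L^2$-projection of the initial functions onto $\mathcal V_h$, such that for every $t$ one has $\rho_h>0$ and $\varphi_h\in[0,1]$ a.e., $\rho_h^{-1}$, $F(\rho_h,\varphi_h)$, $\rho_h|\mathbf v_h|^2\in C^0([0,t_{\rm end}];L^2(\Omega))$, and such that for all $0\le n<N$ and all $(\psi,\mathbf X,\Theta,\chi,\zeta,\mathbf Z)\in\mathcal V_h$ (in (1)–(5), $\rho,\mathbf v,\varphi,\mu,\tau,\boldsymbol\sigma$ without superscript denote the values at $n+\frac12$) $$\begin{aligned} (1)\ 0&=\int_\Omega\Big(\tfrac{\rho_h^{n+1}-\rho_h^n}{\Delta t_n}+\operatorname{div}(\rho\mathbf v)\Big)\psi\,dx-\int_{\mathcal E}[\rho\mathbf v]\{\psi\}\,ds,\\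 (2)\ 0&=\int_\Omega\Big(\rho\tfrac{\mathbf v_h^{n+1}-\mathbf v_h^n}{\Delta t_n}+\operatorname{div}(\rho\mathbf v\otimes\mathbf v)-\operatorname{div}(\rho\mathbf v)\mathbf v-\tfrac12\rho\nabla|\mathbf v|^2+\rho\nabla\tau-\mu\nabla\varphi\Big)\cdot\mathbf X\,dx\\ &\quad-\int_{\mathcal E}[\tau]\cdot\{\rho\mathbf X\}-[\varphi]\cdot\{\mu\mathbf X\}\,ds+B_h[\varphi;\mathbf v,\mathbf X],\\ (3)\ 0&=\int_\Omega\Big(\tfrac{\varphi_h^{n+1}-\varphi_h^n}{\Delta t_n}+\nabla\varphi\cdot\mathbf v+\eta\tfrac{\mu}{\rho}\Big)\Theta\,dx-\int_{\mathcal E}[\varphi]\cdot\{\Theta\mathbf v\}\,ds,\\ (4)\ 0&=\int_\Omega\big(\mu-Q_\varphi+\gamma\operatorname{div}\boldsymbol\sigma\big)\chi\,dx-\int_{\mathcal E}\gamma[\boldsymbol\sigma]\{\chi\}\,ds,\\ (5)\ 0&=\int_\Omega\big(\tau-Q_\rho-\tfrac14(|\mathbf v_h^{n+1}|^2+|\mathbf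 v_h^n|^2)\big)\zeta\,dx,\\ (6)\ 0&=\int_\Omega(\boldsymbol\sigma_h^{n+1}-\nabla\varphi_h^{n+1})\cdot\mathbf Z\,dx+\int_{\mathcal E}[\varphi_h^{n+1}]\cdot\{\mathbf Z\}\,ds, \end{aligned}$$ where $$Q_\varphi=\frac{F(\rho^{n+1}_h,\varphi^{n+1}_h)-F(\rho^{n+1}_h,\varphi^{n}_h)+F(\rho^{n}_h,\varphi^{n+1}_h)-F(\rho^{n}_h,\varphi^{n}_h)}{2(\varphi^{n+1}_h-\varphi^n_h)},$$ $$Q_\rho=\frac{F(\rho^{n+1}_h,\varphi^{n+1}_h)-F(\rho^{n}_h,\varphi^{n+1}_h)+F(\rho^{n+1}_h,\varphi^{n}_h)-F(\rho^{n}_h,\varphi^{n}_h)}{2(\rho^{n+1}_h-\rho^n_h)}$$ are assumed integrable on $\Omega$ (where a denominator vanishes, the difference quotients are read as the corresponding derivatives). Then every fully discrete dG approximation satisfies: 1. (mass conservation) $\int_\Omega\rho_h(x,t)\,dx=\int_\Omega\rho_0(x)\,dx$ for all $t\in[0,t_{\rm end}]$; 2. (energy dissipation) with $\hat E_h(t_n)=\int_\Omega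 F(\rho_h^n,\varphi_h^n)+\frac\gamma2|\boldsymbol\sigma_h^n|^2+\frac{\rho_h^n}2|\mathbf v_h^n|^2\,dx$, $$\hat E_h(t_{n+1})\le\hat E_h(t_n)-\Delta t_n\int_\Omega\eta\frac{|\mu_h^{n+\frac12}|^2}{\rho_h^{n+\frac12}}\,dx-\Delta t_n\,B_h\big[\varphi_h^{n+\frac12};\mathbf v_h^{n+\frac12},\mathbf v_h^{n+\frac12}\big]$$ for every $1\le n<N$, and also for $n=0<N$ provided that the discrete initial data satisfy the discrete gradient relation $0=\int_\Omega(\boldsymbol\sigma_h^0-\nabla\varphi_h^0)\cdot\mathbf Z\,dx+\int_{\mathcal E}[\varphi_h^0]\cdot\{\mathbf Z\}\,ds$ for all $\mathbf Z\in V_{h,\mathbf n}$. -/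

import Mathlib

open scoped MeasureTheory Matrix Topology

noncomputable section

namespace NSAC

/-- The Euclidean space of dimension `d`. -/
abbrev E (d : ℕ) : Type := EuclideanSpace ℝ (Fin d)

/-! ### Conforming simplicial meshes -/

/-- A conforming triangulation of (the closure of) `Ω`.  A mesh element is recorded by the set `K`
of its `d + 1` vertices; the element itself is the open simplex `interior (convexHull ℝ K)`.
Two closed elements meet in the closed simplex spanned by their common vertices, which is a common
sub-simplex (possibly empty). -/
structure Triangulation (d : ℕ) (Ω : Set (E d)) where
  cells : Finset (Finset (E d))
  card_cell : ∀ K ∈ cells, K.card = d + 1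
  indep : ∀ K ∈ cells, AffineIndependent ℝ (fun p : K => (p : E d))
  conforming : ∀ K ∈ cells, ∀ L ∈ cells,
    convexHull ℝ (K : Set (E d)) ∩ convexHull ℝ (L : Set (E d)) =
      convexHull ℝ ((K : Set (E d)) ∩ (L : Set (E d)))
  cover : (⋃ K ∈ cells, convexHull ℝ (K : Set (E d))) = closure Ω

variable {d : ℕ} {Ω : Set (E d)}

/-- The type of mesh elements. -/
abbrev Cell (T : Triangulation d Ω) : Type := {K : Finset (E d) // K ∈ T.cells}

/-- The open simplex belonging to a mesh element. -/
def openCell (T : Triangulation d Ω) (K : Cell T) : Set (E d) :=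
  interior (convexHull ℝ (K.1 : Set (E d)))

/-- All facets (`(d-1)`-dimensional faces, given by their `d` vertices) of the mesh elements. -/
def facets (T : Triangulation d Ω) : Finset (Finset (E d)) := by
  classical exact T.cells.biUnion (fun K => K.powersetCard d)

/-- The mesh elements that have `F` as a facet. -/
def adj (T : Triangulation d Ω) (F : Finset (E d)) : Finset (Cell T) := by
  classical exact Finset.univ.filter (fun K : Cell T => F ⊆ K.1)

/-- The interfaces: facets shared by two distinct mesh elements. -/
def interfaces (T : Triangulation d Ω) : Finset (Finset (E d)) := by
  classical exact (facets T).filter (fun F => (adj T F).card = 2)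

/-- The boundary facets: facets that lie in `∂Ω`. -/
def boundaryFacets (T : Triangulation d Ω) : Finset (Finset (E d)) := by
  classical exact (facets T).filter (fun F => convexHull ℝ (F : Set (E d)) ⊆ frontier Ω)

/-- Interfaces together with boundary facets. -/
def allFaces (T : Triangulation d Ω) : Finset (Finset (E d)) := by
  classical exact interfaces T ∪ boundaryFacets T

/-- `ν` is the outward unit normal of the simplex `K` on its facet `F`. -/
def IsOutwardNormal (K F : Finset (E d)) (ν : E d) : Prop :=
  ‖ν‖ = 1 ∧ (∀ p ∈ F, ∀ q ∈ F, inner ℝ ν (q - p) = 0) ∧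
    ∀ r ∈ K, r ∉ F → ∀ p ∈ F, inner ℝ ν (r - p) < 0

/-- The outward unit normal of the simplex `K` on its facet `F` (it exists and is unique for a
facet of a nondegenerate simplex). -/
def outwardNormal (K F : Finset (E d)) : E d := by
  classical exact if h : ∃ ν, IsOutwardNormal K F ν then h.choose else 0

/-! ### Integrals of broken functions

A broken function is a family of functions, one for every mesh element. -/

/-- `∫_Ω g dx` for a broken function `g`, that is, the sum of the integrals over the elements. -/
def volInt (T : Triangulation d Ω) (g : Cell T → E d → ℝ) : ℝ :=
  ∑ K : Cell T, ∫ x in openCell T K, g K x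

/-- `∫_e g ds`: integral over a facet with respect to the surface measure, i.e. the
`(d-1)`-dimensional Euclidean Hausdorff measure. -/
def facetInt (F : Finset (E d)) (g : E d → ℝ) : ℝ :=
  ∫ x in convexHull ℝ (F : Set (E d)), g x ∂μHE[d - 1]

/-- The surface measure `|e|` of a facet. -/
def facetArea (F : Finset (E d)) : ℝ :=
  (μHE[d - 1] (convexHull ℝ (F : Set (E d)))).toReal

/-- The sum over all interfaces of the facet integrals. -/
def interfaceInt (T : Triangulation d Ω) (g : Finset (E d) → E d → ℝ) : ℝ :=
  ∑ F ∈ interfaces T, facetInt F (g F)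

/-- The sum over all interfaces and all boundary facets of the facet integrals. -/
def allFacesInt (T : Triangulation d Ω) (g : Finset (E d) → E d → ℝ) : ℝ :=
  ∑ F ∈ allFaces T, facetInt F (g F)

/-! ### Averages and jumps

On an interface the sums below run over the two adjacent elements, on a boundary facet over the
single adjacent element. -/

/-- The average `{Φ}` (of a scalar-, vector- or matrix-valued broken function). -/
def avg (T : Triangulation d Ω) {M : Type} [AddCommGroup M] [Module ℝ M]
    (F : Finset (E d)) (g : Cell T → E d → M) (x : E d) : M :=
  ((adj T F).card : ℝ)⁻¹ • ∑ K ∈ adj T F, g K x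

/-- The (vector-valued) jump `[Φ] = ∑ Φ|_K n_K` of a scalar broken function. -/
def jump (T : Triangulation d Ω) (F : Finset (E d)) (g : Cell T → E d → ℝ) (x : E d) :
    Fin d → ℝ :=
  fun i => ∑ K ∈ adj T F, g K x * outwardNormal K.1 F i

/-- The (scalar) jump `[u] = ∑ u|_K · n_K` of a vector-valued broken function. -/
def jumpVec (T : Triangulation d Ω) (F : Finset (E d)) (u : Cell T → E d → Fin d → ℝ)
    (x : E d) : ℝ :=
  ∑ K ∈ adj T F, ∑ i, u K x i * outwardNormal K.1 F i

/-- The tensor jump `[u]_⊗ = ∑ u|_K ⊗ n_K` of a vector-valued broken function. -/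
def jumpTensor (T : Triangulation d Ω) (F : Finset (E d)) (u : Cell T → E d → Fin d → ℝ)
    (x : E d) : Matrix (Fin d) (Fin d) ℝ :=
  Matrix.of fun i j => ∑ K ∈ adj T F, u K x i * outwardNormal K.1 F j

/-- The contraction `A : B`. -/
def contract (A B : Matrix (Fin d) (Fin d) ℝ) : ℝ := ∑ i, ∑ j, A i j * B i j

/-! ### Broken polynomials and the discrete spaces -/

/-- Broken polynomials: one polynomial for every mesh element (with pointwise ring operations). -/
abbrev BPoly (T : Triangulation d Ω) : Type := Cell T → MvPolynomial (Fin d) ℝ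

/-- The values of a broken polynomial. On the boundary of an element this is its one-sided
trace. -/
def ev {T : Triangulation d Ω} (p : BPoly T) (K : Cell T) (x : E d) : ℝ :=
  MvPolynomial.eval (fun i => x i) (p K)

/-- The values of a vector of broken polynomials. -/
def evVec {T : Triangulation d Ω} (u : Fin d → BPoly T) (K : Cell T) (x : E d) : Fin d → ℝ :=
  fun i => ev (u i) K x

/-- The elementwise partial derivative `∂_i`. -/
def D {T : Triangulation d Ω} (i : Fin d) (p : BPoly T) : BPoly T :=
  fun K => MvPolynomial.pderiv i (p K)

/-- The elementwise divergence. -/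
def divg {T : Triangulation d Ω} (u : Fin d → BPoly T) : BPoly T := ∑ i, D i (u i)

/-- The values of the elementwise Jacobian `(∇u)_{ij} = ∂_j u_i`. -/
def gradVec {T : Triangulation d Ω} (u : Fin d → BPoly T) (K : Cell T) (x : E d) :
    Matrix (Fin d) (Fin d) ℝ :=
  Matrix.of fun i j => ev (D j (u i)) K x

/-- `V_h`: broken polynomials of degree at most `k`. -/
def Vh (T : Triangulation d Ω) (k : ℕ) : Set (BPoly T) :=
  {u | ∀ K, (u K).totalDegree ≤ k}

/-- `(V_{h,0})^d`: vector-valued, zero trace on `∂Ω`. -/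
def VhZero (T : Triangulation d Ω) (k : ℕ) : Set (Fin d → BPoly T) :=
  {v | (∀ i, v i ∈ Vh T k) ∧ ∀ F ∈ boundaryFacets T, ∀ K ∈ adj T F,
    ∀ x ∈ convexHull ℝ (F : Set (E d)), ∀ i, ev (v i) K x = 0}

/-- `V_{h,n}`: vector-valued, zero normal trace on `∂Ω`. -/
def VhNormal (T : Triangulation d Ω) (k : ℕ) : Set (Fin d → BPoly T) :=
  {s | (∀ i, s i ∈ Vh T k) ∧ ∀ F ∈ boundaryFacets T, ∀ K ∈ adj T F,
    ∀ x ∈ convexHull ℝ (F : Set (E d)), ∑ i, ev (s i) K x * outwardNormal K.1 F i = 0}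

/-- Six-tuples `(ρ, v, φ, μ, τ, σ)` of broken polynomials. -/
abbrev State (T : Triangulation d Ω) : Type :=
  BPoly T × (Fin d → BPoly T) × BPoly T × BPoly T × BPoly T × (Fin d → BPoly T)

namespace State
variable {T : Triangulation d Ω}
def rho (U : State T) : BPoly T := U.1
def vel (U : State T) : Fin d → BPoly T := U.2.1
def phi (U : State T) : BPoly T := U.2.2.1
def mu (U : State T) : BPoly T := U.2.2.2.1
def tau (U : State T) : BPoly T := U.2.2.2.2.1
def sig (U : State T) : Fin d → BPoly T := U.2.2.2.2.2
end State

/-- `𝒱_h = V_h × (V_{h,0})^d × V_h × V_h × V_h × V_{h,n}`. -/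
def StateSpace (T : Triangulation d Ω) (k : ℕ) : Set (State T) :=
  {U | U.rho ∈ Vh T k ∧ U.vel ∈ VhZero T k ∧ U.phi ∈ Vh T k ∧ U.mu ∈ Vh T k ∧
    U.tau ∈ Vh T k ∧ U.sig ∈ VhNormal T k}

/-! ### Initial data and the `L²`-projection -/

/-- Initial functions `(ρ₀, v₀, φ₀, μ₀, τ₀, σ₀)` in `L²(Ω)`. -/
structure InitialData (Ω : Set (E d)) where
  rho : E d → ℝ
  vel : E d → Fin d → ℝ
  phi : E d → ℝ
  mu : E d → ℝ
  tau : E d → ℝ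
  sig : E d → Fin d → ℝ
  rho_mem : MeasureTheory.MemLp rho 2 (MeasureTheory.volume.restrict Ω)
  vel_mem : ∀ i, MeasureTheory.MemLp (fun x => vel x i) 2 (MeasureTheory.volume.restrict Ω)
  phi_mem : MeasureTheory.MemLp phi 2 (MeasureTheory.volume.restrict Ω)
  mu_mem : MeasureTheory.MemLp mu 2 (MeasureTheory.volume.restrict Ω)
  tau_mem : MeasureTheory.MemLp tau 2 (MeasureTheory.volume.restrict Ω)
  sig_mem : ∀ i, MeasureTheory.MemLp (fun x => sig x i) 2 (MeasureTheory.volume.restrict Ω)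

/-- `u - f` is `L²`-orthogonal to `V_h`. -/
def IsProjScalar (T : Triangulation d Ω) (k : ℕ) (f : E d → ℝ) (u : BPoly T) : Prop :=
  ∀ ψ ∈ Vh T k, volInt T (fun K x => ev u K x * ev ψ K x) =
    volInt T (fun K x => f x * ev ψ K x)

/-- `u - f` is `L²`-orthogonal to the space `W` of vector-valued broken polynomials. -/
def IsProjVec (T : Triangulation d Ω) (W : Set (Fin d → BPoly T)) (f : E d → Fin d → ℝ)
    (u : Fin d → BPoly T) : Prop :=
  ∀ X ∈ W, volInt T (fun K x => evVec u K x ⬝ᵥ evVec X K x) =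
    volInt T (fun K x => f x ⬝ᵥ evVec X K x)

/-- `U = Π_h U₀`, where `Π_h` is the `L²`-projection onto `𝒱_h`. -/
def IsL2Projection (T : Triangulation d Ω) (k : ℕ) (U₀ : InitialData Ω) (U : State T) : Prop :=
  U ∈ StateSpace T k ∧
  IsProjScalar T k U₀.rho U.rho ∧ IsProjVec T (VhZero T k) U₀.vel U.vel ∧
  IsProjScalar T k U₀.phi U.phi ∧ IsProjScalar T k U₀.mu U.mu ∧
  IsProjScalar T k U₀.tau U.tau ∧ IsProjVec T (VhNormal T k) U₀.sig U.sig

/-! ### Constitutive data, viscous form, energy -/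

/-- Constitutive data: the function `f̃(ρ, φ)`, the two viscosities as functions of `φ`, the
capillarity `γ`, the mobility `η`, the interior penalty parameter `α_B`. -/
structure Params where
  ftilde : ℝ → ℝ → ℝ
  visc₁ : ℝ → ℝ
  visc₂ : ℝ → ℝ
  gamma : ℝ
  eta : ℝ
  alphaB : ℝ

/-- The energy density `ρ f̃(ρ, φ)`. -/
def Params.dens (P : Params) (r p : ℝ) : ℝ := r * P.ftilde r p

/-- The Newtonian viscous stress `S(∇v, φ) = ν₁(φ) (∇v + ∇vᵀ) + ν₂(φ) div(v) I`. -/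
def Params.stress (P : Params) (G : Matrix (Fin d) (Fin d) ℝ) (p : ℝ) :
    Matrix (Fin d) (Fin d) ℝ :=
  P.visc₁ p • (G + Gᵀ) + (P.visc₂ p * G.trace) • (1 : Matrix (Fin d) (Fin d) ℝ)

/-- The broken function `S(∇v, φ)`. -/
def stressField {T : Triangulation d Ω} (P : Params) (φ : BPoly T) (v : Fin d → BPoly T)
    (K : Cell T) (x : E d) : Matrix (Fin d) (Fin d) ℝ :=
  P.stress (gradVec v K x) (ev φ K x)

/-- The symmetric interior penalty form `B_h[φ; v, X]`. -/
def Bh (T : Triangulation d Ω) (P : Params) (φ : BPoly T) (v X : Fin d → BPoly T) : ℝ :=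
  volInt T (fun K x => contract (stressField P φ v K x) (gradVec X K x))
  - allFacesInt T (fun F x =>
      contract (avg T F (stressField P φ v) x) (jumpTensor T F (evVec X) x)
      + contract (avg T F (stressField P φ X) x) (jumpTensor T F (evVec v) x))
  + allFacesInt T (fun F x => P.alphaB / facetArea F *
      contract (jumpTensor T F (evVec v) x) (jumpTensor T F (evVec X) x))

/-- The discrete energy `∫ ρ f̃(ρ, φ) + γ/2 |σ|² + ρ/2 |v|²`. -/
def energy (T : Triangulation d Ω) (P : Params) (U : State T) : ℝ :=
  volInt T (fun K x => P.dens (ev U.rho K x) (ev U.phi K x)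
    + P.gamma / 2 * (evVec U.sig K x ⬝ᵥ evVec U.sig K x)
    + ev U.rho K x / 2 * (evVec U.vel K x ⬝ᵥ evVec U.vel K x))

/-! ### The fully discrete scheme -/

/-- The discrete `φ`-derivative of `ρ f̃`,
`(F(ρ₁,φ₁) - F(ρ₁,φ₀) + F(ρ₀,φ₁) - F(ρ₀,φ₀)) / (2 (φ₁ - φ₀))` with `F(ρ,φ) = ρ f̃(ρ,φ)`;
where `φ₁ = φ₀` the difference quotients are read as derivatives. -/
def Params.dqPhi (P : Params) (r₀ p₀ r₁ p₁ : ℝ) : ℝ :=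
  (dslope (fun p => P.dens r₁ p) p₀ p₁ + dslope (fun p => P.dens r₀ p) p₀ p₁) / 2

/-- The discrete `ρ`-derivative of `ρ f̃`,
`(F(ρ₁,φ₁) - F(ρ₀,φ₁) + F(ρ₁,φ₀) - F(ρ₀,φ₀)) / (2 (ρ₁ - ρ₀))`;
where `ρ₁ = ρ₀` the difference quotients are read as derivatives. -/
def Params.dqRho (P : Params) (r₀ p₀ r₁ p₁ : ℝ) : ℝ :=
  (dslope (fun r => P.dens r p₁) r₀ r₁ + dslope (fun r => P.dens r p₀) r₀ r₁) / 2

/-- `dqPhi` for two states, as a broken function. -/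
def dqPhiField {T : Triangulation d Ω} (P : Params) (U₀ U₁ : State T) (K : Cell T) (x : E d) : ℝ :=
  P.dqPhi (ev U₀.rho K x) (ev U₀.phi K x) (ev U₁.rho K x) (ev U₁.phi K x)

/-- `dqRho` for two states, as a broken function. -/
def dqRhoField {T : Triangulation d Ω} (P : Params) (U₀ U₁ : State T) (K : Cell T) (x : E d) : ℝ :=
  P.dqRho (ev U₀.rho K x) (ev U₀.phi K x) (ev U₁.rho K x) (ev U₁.phi K x)

/-- The midpoint `U^{n+1/2} = (U^n + U^{n+1}) / 2`. -/
def mid {T : Triangulation d Ω} (U₀ U₁ : State T) : State T := (1 / 2 : ℝ) • (U₀ + U₁)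

/-- Mass equation. -/
def EqRho (T : Triangulation d Ω) (k : ℕ) (δ : ℝ) (U₀ U₁ : State T) : Prop :=
  let U := mid U₀ U₁
  ∀ ψ ∈ Vh T k,
    0 = volInt T (fun K x =>
          ((ev U₁.rho K x - ev U₀.rho K x) / δ + ev (divg (fun i => U.rho * U.vel i)) K x)
            * ev ψ K x)
      - interfaceInt T (fun F x =>
          jumpVec T F (evVec (fun i => U.rho * U.vel i)) x * avg T F (ev ψ) x)

/-- Momentum equation. -/
def EqVel (T : Triangulation d Ω) (k : ℕ) (P : Params) (δ : ℝ) (U₀ U₁ : State T) : Prop :=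
  let U := mid U₀ U₁
  ∀ X ∈ VhZero T k,
    0 = volInt T (fun K x => ∑ i,
          (ev U.rho K x * ((ev (U₁.vel i) K x - ev (U₀.vel i) K x) / δ)
            + ev (divg (fun j => U.rho * U.vel i * U.vel j)) K x
            - ev (divg (fun j => U.rho * U.vel j)) K x * ev (U.vel i) K x
            - 1 / 2 * ev U.rho K x * ev (D i (∑ j, U.vel j * U.vel j)) K x
            + ev U.rho K x * ev (D i U.tau) K x
            - ev U.mu K x * ev (D i U.phi) K x) * ev (X i) K x)
      - interfaceInt T (fun F x =>
          jump T F (ev U.tau) x ⬝ᵥ avg T F (evVec (fun i => U.rho * X i)) x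
          - jump T F (ev U.phi) x ⬝ᵥ avg T F (evVec (fun i => U.mu * X i)) x)
      + Bh T P U.phi U.vel X

/-- Phase field equation. -/
def EqPhi (T : Triangulation d Ω) (k : ℕ) (P : Params) (δ : ℝ) (U₀ U₁ : State T) : Prop :=
  let U := mid U₀ U₁
  ∀ Θ ∈ Vh T k,
    0 = volInt T (fun K x =>
          ((ev U₁.phi K x - ev U₀.phi K x) / δ
            + ∑ i, ev (D i U.phi) K x * ev (U.vel i) K x
            + P.eta * (ev U.mu K x / ev U.rho K x)) * ev Θ K x)
      - interfaceInt T (fun F x =>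
          jump T F (ev U.phi) x ⬝ᵥ avg T F (evVec (fun i => Θ * U.vel i)) x)

/-- Equation for `μ`. -/
def EqMu (T : Triangulation d Ω) (k : ℕ) (P : Params) (U₀ U₁ : State T) : Prop :=
  let U := mid U₀ U₁
  ∀ χ ∈ Vh T k,
    0 = volInt T (fun K x =>
          (ev U.mu K x - dqPhiField P U₀ U₁ K x + P.gamma * ev (divg U.sig) K x) * ev χ K x)
      - interfaceInt T (fun F x =>
          P.gamma * jumpVec T F (evVec U.sig) x * avg T F (ev χ) x)

/-- Equation for `τ`. -/
def EqTau (T : Triangulation d Ω) (k : ℕ) (P : Params) (U₀ U₁ : State T) : Prop :=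
  let U := mid U₀ U₁
  ∀ ζ ∈ Vh T k,
    0 = volInt T (fun K x =>
          (ev U.tau K x - dqRhoField P U₀ U₁ K x
            - 1 / 4 * (evVec U₁.vel K x ⬝ᵥ evVec U₁.vel K x
                + evVec U₀.vel K x ⬝ᵥ evVec U₀.vel K x)) * ev ζ K x)

/-- Equation for `σ`: `σ` is the discrete gradient of `φ`. -/
def EqSig (T : Triangulation d Ω) (k : ℕ) (U : State T) : Prop :=
  ∀ Z ∈ VhNormal T k,
    0 = volInt T (fun K x =>
          ∑ i, (ev (U.sig i) K x - ev (D i U.phi) K x) * ev (Z i) K x)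
      + interfaceInt T (fun F x => jump T F (ev U.phi) x ⬝ᵥ avg T F (evVec Z) x)

/-- The broken function `g` of time belongs to `C⁰([0, tEnd]; L²(Ω))`. -/
def ContinuousInL2 (T : Triangulation d Ω) (tEnd : ℝ) (g : ℝ → Cell T → E d → ℝ) : Prop :=
  ∀ K, (∀ s ∈ Set.Icc 0 tEnd,
      MeasureTheory.MemLp (g s K) 2 (MeasureTheory.volume.restrict (openCell T K))) ∧
    ∀ s₀ ∈ Set.Icc 0 tEnd, Filter.Tendsto
      (fun s => MeasureTheory.eLpNorm (g s K - g s₀ K) 2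
        (MeasureTheory.volume.restrict (openCell T K)))
      (𝓝[Set.Icc 0 tEnd] s₀) (𝓝 0)

/-- `U : [0, t_N] → 𝒱_h` is a fully discrete dG approximation with initial functions `Uinit`, on the
time grid `0 = t_0 < ... < t_N`. -/
structure IsFullyDiscrete (T : Triangulation d Ω) (k : ℕ) (P : Params) (Uinit : InitialData Ω)
    (N : ℕ) (t : ℕ → ℝ) (U : ℝ → State T) : Prop where
  mem : ∀ s ∈ Set.Icc 0 (t N), U s ∈ StateSpace T k
  init : IsL2Projection T k Uinit (U 0)
  interpolates : ∀ n < N, ∀ s ∈ Set.Icc (t n) (t (n + 1)),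
    U s = ((s - t n) / (t (n + 1) - t n)) • (U (t (n + 1)) - U (t n)) + U (t n)
  bounds : ∀ s ∈ Set.Icc 0 (t N), ∀ K,
    ∀ᵐ x ∂(MeasureTheory.volume.restrict (openCell T K)),
      0 < ev (U s).rho K x ∧ ev (U s).phi K x ∈ Set.Icc (0 : ℝ) 1
  inv_rho : ContinuousInL2 T (t N) (fun s K x => (ev (U s).rho K x)⁻¹)
  dens : ContinuousInL2 T (t N) (fun s K x => P.dens (ev (U s).rho K x) (ev (U s).phi K x))
  kinetic : ContinuousInL2 T (t N) (fun s K x =>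
    ev (U s).rho K x * (evVec (U s).vel K x ⬝ᵥ evVec (U s).vel K x))
  /-- The volume integrals in the equations for `μ` and `τ` are well defined. -/
  integrable : ∀ n < N, ∀ K,
    MeasureTheory.IntegrableOn (dqPhiField P (U (t n)) (U (t (n + 1))) K) (openCell T K) ∧
    MeasureTheory.IntegrableOn (dqRhoField P (U (t n)) (U (t (n + 1))) K) (openCell T K)
  eq_rho : ∀ n < N, EqRho T k (t (n + 1) - t n) (U (t n)) (U (t (n + 1)))
  eq_vel : ∀ n < N, EqVel T k P (t (n + 1) - t n) (U (t n)) (U (t (n + 1)))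
  eq_phi : ∀ n < N, EqPhi T k P (t (n + 1) - t n) (U (t n)) (U (t (n + 1)))
  eq_mu : ∀ n < N, EqMu T k P (U (t n)) (U (t (n + 1)))
  eq_tau : ∀ n < N, EqTau T k P (U (t n)) (U (t (n + 1)))
  eq_sig : ∀ n < N, EqSig T k (U (t (n + 1)))

end NSAC

end

/-!
Elementwise integration by parts makes the gradient form with the jump `[p]` and the divergence
form with the jump `[u]` negative adjoints whenever `u` has zero normal trace; on a simplex it comes
from integrating along the rays of the cones over the facets. The symmetric averaging of the
difference quotients gives the exact discrete chain rule
`F(ρ₁, φ₁) - F(ρ₀, φ₀) = Q_φ (φ₁ - φ₀) + Q_ρ (ρ₁ - ρ₀)`. Hence testing the equations for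
`ρ, v, φ, μ, τ` with `τ, v, μ, φ₁ - φ₀, ρ₁ - ρ₀` and the two equations for `σ` with the midpoint of
`σ`, everything cancels except the energy difference, the mobility term and `B_h`; the average of
`|v₁|²` and `|v₀|²` in the equation for `τ` is what splits the kinetic energy exactly. Mass is
conserved by testing with `1`.
-/

noncomputable section

namespace NSAC

open MeasureTheory Module Topology

/-! ### Integration over cones -/

theorem setIntegral_homothety_image {V : Type*} [NormedAddCommGroup V] [NormedSpace ℝ V]
    [MeasurableSpace V] [BorelSpace V] (m : ℕ) (a : V) {s : ℝ} (hs : 0 < s) (F : Set V)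
    (q : V → ℝ) :
    ∫ y in AffineMap.homothety a s '' F, q y ∂μHE[m] =
      s ^ m * ∫ y in F, q (AffineMap.homothety a s y) ∂μHE[m] := by
  have hinj : Function.Injective (AffineMap.homothety a s) := fun x y hxy => by
    simpa [AffineMap.homothety_apply, hs.ne'] using hxy
  have hemb : MeasurableEmbedding (AffineMap.homothety a s) :=
    (IsOpenEmbedding.of_continuous_injective_isOpenMap (AffineMap.homothety_continuous a s) hinj
      (AffineMap.homothety_isOpenMap a s hs.ne')).measurableEmbedding
  have hmap : Measure.map (AffineMap.homothety a s) μHE[m] =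
      (‖s‖₊⁻¹ ^ m) • (μHE[m] : Measure V) := by
    ext A hA
    rw [Measure.map_apply hemb.measurable hA,
      euclideanHausdorffMeasure_homothety_preimage m a hs.ne', Measure.smul_apply]
  have h := hemb.setIntegral_map (μ := μHE[m]) q (AffineMap.homothety a s '' F)
  rw [hmap, hinj.preimage_image, Measure.restrict_smul, integral_smul_nnreal_measure] at h
  rw [← h, NNReal.smul_def, smul_eq_mul, NNReal.coe_pow, NNReal.coe_inv, coe_nnnorm,
    Real.norm_of_nonneg hs.le, ← mul_assoc, ← mul_pow, mul_inv_cancel₀ hs.ne', one_pow, one_mul]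

theorem integral_deriv_along_ray {V : Type*} [NormedAddCommGroup V] [NormedSpace ℝ V] (a y : V)
    {p : V → ℝ} (hp : ContDiff ℝ 1 p) {m : ℕ} (hm : m ≠ 0) :
    ∫ s in (0 : ℝ)..1, s ^ (m - 1) * (m * p (AffineMap.homothety a s y) +
      fderiv ℝ p (AffineMap.homothety a s y) (AffineMap.homothety a s y - a)) = p y := by
  have hderiv : ∀ s ∈ Set.uIcc (0 : ℝ) 1,
      HasDerivAt (fun s : ℝ => s ^ m * p (AffineMap.homothety a s y))
        (s ^ (m - 1) * (m * p (AffineMap.homothety a s y) +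
          fderiv ℝ p (AffineMap.homothety a s y) (AffineMap.homothety a s y - a))) s := by
    intro s _
    have hray : HasDerivAt (fun s : ℝ => AffineMap.homothety a s y) (y - a) s := by
      simpa [AffineMap.homothety_apply] using
        ((hasDerivAt_id s).smul_const (y - a)).add_const a
    have hcomp := (hp.differentiable one_ne_zero _).hasFDerivAt.comp_hasDerivAt s hray
    refine ((hasDerivAt_pow m s).mul hcomp).congr_deriv ?_
    obtain ⟨l, rfl⟩ := Nat.exists_eq_add_one_of_ne_zero hm
    simp [AffineMap.homothety_apply]
    ring
  have hcont : Continuous fun s : ℝ => s ^ (m - 1) * (m * p (AffineMap.homothety a s y) +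
      fderiv ℝ p (AffineMap.homothety a s y) (AffineMap.homothety a s y - a)) := by
    have hp' := hp.continuous
    have := hp.continuous_fderiv one_ne_zero
    simp only [AffineMap.homothety_apply]
    fun_prop
  rw [intervalIntegral.integral_eq_sub_of_hasDerivAt hderiv (hcont.intervalIntegrable _ _)]
  simp [hm]

theorem intervalIntegral_setIntegral_swap {α : Type*} [TopologicalSpace α] [MeasurableSpace α]
    [OpensMeasurableSpace α] [SecondCountableTopology α] {μ : Measure α} {F : Set α}
    (hF : IsCompact F) (hFm : MeasurableSet F) (hμF : μ F < ⊤) {g : ℝ → α → ℝ}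
    (hg : Continuous (Function.uncurry g)) (b c : ℝ) :
    ∫ s in b..c, ∫ y in F, g s y ∂μ = ∫ y in F, (∫ s in b..c, g s y) ∂μ := by
  have : IsFiniteMeasure (μ.restrict F) := ⟨by rwa [Measure.restrict_apply_univ]⟩
  refine intervalIntegral_integral_swap ?_
  have hint : IntegrableOn (Function.uncurry g) (Set.uIcc b c ×ˢ F)
      (volume.prod (μ.restrict F)) :=
    hg.continuousOn.integrableOn_compact' (isCompact_uIcc.prod hF) (measurableSet_uIcc.prod hFm)
  rw [IntegrableOn, ← Measure.prod_restrict, Measure.restrict_restrict hFm, Set.inter_self] at hint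
  exact hint.mono_measure
    (Measure.prod_mono (Measure.restrict_mono Set.uIoc_subset_uIcc le_rfl) le_rfl)

section Cone

variable {V : Type*} [NormedAddCommGroup V] [InnerProductSpace ℝ V] {n a : V} {h : ℝ} {F : Set V}

theorem isometry_orthogonal_add (x₀ : V) : Isometry fun z : (ℝ ∙ n)ᗮ => (z : V) + x₀ :=
  (IsometryEquiv.addRight x₀).isometry.comp (Submodule.subtypeₗᵢ _).isometry

theorem mem_convexJoin_singleton_iff {x : V} :
    x ∈ convexJoin ℝ {a} F ↔ ∃ s ∈ Set.Icc (0 : ℝ) 1, x ∈ AffineMap.homothety a s '' F := by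
  simp only [convexJoin_singleton_left, Set.mem_iUnion, segment_eq_image_lineMap, Set.mem_image,
    exists_prop, AffineMap.homothety_eq_lineMap]
  tauto

theorem isCompact_convexJoin_singleton (a : V) (hF : IsCompact F) :
    IsCompact (convexJoin ℝ {a} F) := by
  have himage : convexJoin ℝ {a} F =
      (fun p : ℝ × V => AffineMap.homothety a p.1 p.2) '' (Set.Icc 0 1 ×ˢ F) := by
    ext x
    simp only [mem_convexJoin_singleton_iff, Set.mem_image, Set.mem_prod, Prod.exists]
    tauto
  rw [himage]
  refine (isCompact_Icc.prod hF).image ?_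
  simp only [AffineMap.homothety_apply]
  fun_prop

theorem convexJoin_inter_slice (hh : 0 < h) (hF : ∀ x ∈ F, inner ℝ n (x - a) = h) (s : ℝ) :
    convexJoin ℝ {a} F ∩ {x | inner ℝ n (x - a) = h * s} =
      if s ∈ Set.Icc 0 1 then AffineMap.homothety a s '' F else ∅ := by
  have hlevel {r : ℝ} {x : V} (hx : x ∈ AffineMap.homothety a r '' F) :
      inner ℝ n (x - a) = h * r := by
    obtain ⟨y, hy, rfl⟩ := hx
    simp [AffineMap.homothety_apply, inner_smul_right, hF y hy, mul_comm]
  ext x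
  simp only [Set.mem_inter_iff, mem_convexJoin_singleton_iff, Set.mem_ofPred_eq]
  split_ifs with hs
  · refine ⟨?_, fun hx => ⟨⟨s, hs, hx⟩, hlevel hx⟩⟩
    rintro ⟨⟨r, -, hx⟩, hxs⟩
    rwa [← mul_left_cancel₀ hh.ne' ((hlevel hx).symm.trans hxs)]
  · refine iff_of_false ?_ (Set.notMem_empty x)
    rintro ⟨⟨r, hr, hx⟩, hxs⟩
    exact hs (mul_left_cancel₀ hh.ne' ((hlevel hx).symm.trans hxs) ▸ hr)

variable [FiniteDimensional ℝ V]

theorem finrank_orthogonal_span_of_norm_eq_one (hn : ‖n‖ = 1) :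
    finrank ℝ (ℝ ∙ n)ᗮ = finrank ℝ V - 1 := by
  have hn0 : n ≠ 0 := norm_ne_zero_iff.1 (by simp [hn])
  have := (ℝ ∙ n).finrank_add_finrank_orthogonal
  rw [finrank_span_singleton hn0] at this
  lia

variable [MeasurableSpace V] [BorelSpace V]

theorem measurePreserving_smul_add_orthogonal (hn : ‖n‖ = 1) (a : V) :
    MeasurePreserving (fun p : ℝ × (ℝ ∙ n)ᗮ => (p.1 • n + p.2 : V) + a) := by
  have h := ((ℝ ∙ n).measurePreserving_measurableEquivProd a).symm.comp
    ((LinearIsometryEquiv.toSpanUnitSingleton (𝕜 := ℝ) n hn).measurePreserving.prod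
      (MeasurePreserving.id volume))
  rw [InnerProductSpace.euclideanHausdorffMeasure_eq_volume] at h
  convert h using 1
  · ext p
    simp
  · rfl

theorem map_orthogonal_add (hn : ‖n‖ = 1) (x₀ : V) :
    Measure.map (fun z : (ℝ ∙ n)ᗮ => (z : V) + x₀) volume =
      μHE[finrank ℝ V - 1].restrict {x | inner ℝ n (x - x₀) = 0} := by
  rw [← finrank_orthogonal_span_of_norm_eq_one hn,
    ← InnerProductSpace.euclideanHausdorffMeasure_eq_volume,
    (isometry_orthogonal_add x₀).map_euclideanHausdorffMeasure]
  congr 1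
  ext x
  refine ⟨?_, fun hx => ⟨⟨x - x₀, Submodule.mem_orthogonal_singleton_iff_inner_right.2 hx⟩, ?_⟩⟩
  · rintro ⟨z, rfl⟩
    simpa using Submodule.mem_orthogonal_singleton_iff_inner_right.1 z.2
  · simp

theorem euclideanHausdorffMeasure_lt_top_of_isCompact (hn : ‖n‖ = 1) {x₀ : V}
    (hF : IsCompact F) (hflat : ∀ x ∈ F, inner ℝ n (x - x₀) = 0) :
    μHE[finrank ℝ V - 1] F < ⊤ := by
  have hemb := (isometry_orthogonal_add (n := n) x₀).isClosedEmbedding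
  rw [← Set.inter_eq_left.2 (show F ⊆ {x | inner ℝ n (x - x₀) = 0} from hflat),
    ← Measure.restrict_apply hF.measurableSet, ← map_orthogonal_add hn,
    Measure.map_apply hemb.measurableEmbedding.measurable hF.measurableSet]
  exact (hemb.isCompact_preimage hF).measure_lt_top

theorem integral_eq_integral_slices (hn : ‖n‖ = 1) (a : V) {f : V → ℝ} (hf : Integrable f) :
    ∫ x, f x = ∫ r : ℝ, ∫ x in {x | inner ℝ n (x - a) = r}, f x ∂μHE[finrank ℝ V - 1] := by
  have hmp := measurePreserving_smul_add_orthogonal hn a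
  have hslice (r : ℝ) : ∫ z : (ℝ ∙ n)ᗮ, f ((r • n + z : V) + a) =
      ∫ x in {x | inner ℝ n (x - a) = r}, f x ∂μHE[finrank ℝ V - 1] := by
    have hset : {x | inner ℝ n (x - a) = r} = {x | inner ℝ n (x - (r • n + a)) = 0} := by
      ext x
      simp [← sub_sub, sub_right_comm x, inner_sub_right _ _ (r • n), inner_smul_right, hn,
        sub_eq_zero]
    rw [hset, ← map_orthogonal_add hn,
      (isometry_orthogonal_add _).isClosedEmbedding.measurableEmbedding.integral_map]
    simp only [add_left_comm, add_assoc]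
  calc ∫ x, f x = ∫ p : ℝ × (ℝ ∙ n)ᗮ, f ((p.1 • n + p.2 : V) + a) := by
        rw [← hmp.map_eq, integral_map hmp.measurable.aemeasurable
          (hmp.map_eq.symm ▸ hf.aestronglyMeasurable)]
    _ = ∫ r : ℝ, ∫ z : (ℝ ∙ n)ᗮ, f ((r • n + z : V) + a) :=
        integral_prod _ (hmp.integrable_comp_of_integrable hf)
    _ = _ := integral_congr_ae (.of_forall hslice)

theorem setIntegral_cone (hn : ‖n‖ = 1) (hh : 0 < h) (hFc : IsCompact F)
    (hF : ∀ x ∈ F, inner ℝ n (x - a) = h) {q : V → ℝ} (hq : Continuous q) :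
    ∫ x in convexJoin ℝ {a} F, q x = h * ∫ s in (0 : ℝ)..1, s ^ (finrank ℝ V - 1) *
      ∫ y in F, q (AffineMap.homothety a s y) ∂μHE[finrank ℝ V - 1] := by
  have hK := isCompact_convexJoin_singleton a hFc
  let slice (r : ℝ) : ℝ :=
    ∫ x in convexJoin ℝ {a} F ∩ {x | inner ℝ n (x - a) = r}, q x ∂μHE[finrank ℝ V - 1]
  have hslice : ∀ᵐ s : ℝ, slice (h * s) = (Set.Ioc 0 1).indicator (fun s =>
      s ^ (finrank ℝ V - 1) *
        ∫ y in F, q (AffineMap.homothety a s y) ∂μHE[finrank ℝ V - 1]) s := by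
    filter_upwards [Measure.ae_ne volume 0] with s hs0
    simp only [slice, convexJoin_inter_slice hh hF]
    split_ifs with hs
    · have hs' : 0 < s := hs.1.lt_of_ne' hs0
      have hsIoc : s ∈ Set.Ioc 0 1 := ⟨hs', hs.2⟩
      rw [setIntegral_homothety_image _ a hs', Set.indicator_of_mem hsIoc]
    · rw [Set.indicator_of_notMem fun hs' => hs ⟨hs'.1.le, hs'.2⟩, Measure.restrict_empty,
        integral_zero_measure]
  calc ∫ x in convexJoin ℝ {a} F, q x = ∫ r, slice r := by
        rw [← integral_indicator hK.measurableSet, integral_eq_integral_slices hn a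
          ((hq.continuousOn.integrableOn_compact hK).integrable_indicator hK.measurableSet)]
        simp only [slice, setIntegral_indicator hK.measurableSet, Set.inter_comm]
    _ = h * ∫ s, slice (h * s) := by
        rw [Measure.integral_comp_mul_left, abs_of_pos (inv_pos.2 hh), smul_eq_mul,
          mul_inv_cancel_left₀ hh.ne']
    _ = _ := by
        rw [integral_congr_ae hslice, integral_indicator measurableSet_Ioc,
          intervalIntegral.integral_of_le zero_le_one]

theorem setIntegral_radial_cone (hn : ‖n‖ = 1) (hh : 0 < h) (hFc : IsCompact F)
    (hF : ∀ x ∈ F, inner ℝ n (x - a) = h) {p : V → ℝ} (hp : ContDiff ℝ 1 p) :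
    ∫ x in convexJoin ℝ {a} F, (finrank ℝ V * p x + fderiv ℝ p x (x - a)) =
      h * ∫ y in F, p y ∂μHE[finrank ℝ V - 1] := by
  have hV : finrank ℝ V ≠ 0 := by
    have : Nontrivial V := ⟨n, 0, norm_ne_zero_iff.1 (by simp [hn])⟩
    exact finrank_pos.ne'
  have hp' := hp.continuous
  have := hp.continuous_fderiv one_ne_zero
  have hflat : ∀ x₀ ∈ F, ∀ x ∈ F, inner ℝ n (x - x₀) = 0 := fun x₀ hx₀ x hx => by
    rw [← sub_sub_sub_cancel_right x x₀ a, inner_sub_right, hF x hx, hF x₀ hx₀, sub_self]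
  have hfin : μHE[finrank ℝ V - 1] F < ⊤ := by
    obtain rfl | ⟨x₀, hx₀⟩ := F.eq_empty_or_nonempty
    · simp
    · exact euclideanHausdorffMeasure_lt_top_of_isCompact hn hFc (hflat x₀ hx₀)
  rw [setIntegral_cone hn hh hFc hF (by fun_prop)]
  simp only [← integral_const_mul]
  rw [intervalIntegral_setIntegral_swap hFc hFc.measurableSet hfin
    (by simp only [AffineMap.homothety_apply, Function.uncurry_def]; fun_prop), integral_const_mul]
  simp only [integral_deriv_along_ray a _ hp hV]

end Cone

/-! ### Simplices -/

section Simplex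

variable {ι V : Type*}

section Coordinates

variable [AddCommGroup V] [Module ℝ V] (b : AffineBasis ι ℝ V)

theorem sum_coord_linear [Fintype ι] (w : V) : ∑ i, (b.coord i).linear w = 0 := by
  simp only [AffineMap.decomp', Pi.sub_apply, Finset.sum_sub_distrib,
    b.sum_coord_apply_eq_one, sub_self]

theorem sum_coord_linear_smul [Fintype ι] (w : V) : ∑ i, (b.coord i).linear w • b i = w := by
  simp only [AffineMap.decomp', Pi.sub_apply, sub_smul, Finset.sum_sub_distrib,
    b.linear_combination_coord_eq_self, sub_zero]

theorem coord_eq_zero_of_mem_convexHull {s : Set V} {i : ι} (hs : ∀ y ∈ s, b.coord i y = 0)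
    {x : V} (hx : x ∈ convexHull ℝ s) : b.coord i x = 0 :=
  convexHull_min (t := b.coord i ⁻¹' {0}) hs ((convex_singleton 0).affine_preimage _) hx

theorem coord_sum_smul {κ : Type*} (s : Finset κ) (w : κ → ℝ) (y : κ → V)
    (hw : ∑ k ∈ s, w k = 1) (i : ι) :
    b.coord i (∑ k ∈ s, w k • y k) = ∑ k ∈ s, w k * b.coord i (y k) := by
  rw [← s.affineCombination_eq_linear_combination y w hw, s.map_affineCombination y w hw,
    s.affineCombination_eq_linear_combination _ w hw]
  rfl

theorem convexHull_range_eq_convexJoin [Nontrivial ι] (i : ι) :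
    convexHull ℝ (Set.range b) = convexJoin ℝ {b i} (convexHull ℝ (b '' {i}ᶜ)) := by
  rw [← convexHull_insert ((Set.nonempty_compl_of_nontrivial i).image b), ← Set.image_insert_eq,
    Set.insert_eq, Set.union_compl_self, Set.image_univ]

theorem coord_linear_ne_zero [Nontrivial ι] (i : ι) : (b.coord i).linear ≠ 0 := by
  obtain ⟨j, hj⟩ := exists_ne i
  intro h
  have := (b.coord i).linearMap_vsub (b i) (b j)
  rw [h, b.coord_apply_eq, b.coord_apply_ne hj.symm] at this
  simp at this

end Coordinates

variable [NormedAddCommGroup V] [InnerProductSpace ℝ V]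

variable (b : AffineBasis ι ℝ V)

theorem inner_eq_mul_coord_linear [Finite ι] {i k : ι} {ν : V}
    (hν : ∀ j ≠ i, inner ℝ ν (b j - b k) = 0) (w : V) :
    inner ℝ ν w = inner ℝ ν (b i - b k) * (b.coord i).linear w := by
  have := Fintype.ofFinite ι
  have hw : w = ∑ j, (b.coord j).linear w • (b j - b k) := by
    simp only [smul_sub, Finset.sum_sub_distrib, ← Finset.sum_smul, sum_coord_linear,
      sum_coord_linear_smul, zero_smul, sub_zero]
  conv_lhs => rw [hw]
  rw [inner_sum, Finset.sum_eq_single i (fun j _ hj => by rw [inner_smul_right, hν j hj, mul_zero])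
    (by simp), inner_smul_right, mul_comm]

variable [FiniteDimensional ℝ V]

theorem exists_norm_eq_one_inner_eq_neg_mul {g : V →ₗ[ℝ] ℝ} (hg : g ≠ 0) :
    ∃ ν : V, ‖ν‖ = 1 ∧ ∃ h > 0, ∀ w, inner ℝ ν w = -h * g w := by
  let z := (InnerProductSpace.toDual ℝ V).symm (LinearMap.toContinuousLinearMap g)
  have hz (w : V) : inner ℝ z w = g w := InnerProductSpace.toDual_symm_apply
  have hz0 : z ≠ 0 := fun h => hg (LinearMap.ext fun w => by rw [← hz, h, inner_zero_left]; rfl)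
  refine ⟨(-‖z‖⁻¹) • z, ?_, ‖z‖⁻¹, inv_pos.2 (norm_pos_iff.2 hz0), fun w => ?_⟩
  · rw [norm_smul, norm_neg, norm_inv, norm_norm, inv_mul_cancel₀ (norm_ne_zero_iff.2 hz0)]
  · rw [real_inner_smul_left, hz]

variable [MeasurableSpace V] [BorelSpace V] {p : V → ℝ}

theorem setIntegral_radial_simplex [Finite ι] [Nontrivial ι] {i : ι} {ν : V} {h : ℝ}
    (hν : ‖ν‖ = 1) (hh : 0 < h) (hνh : ∀ w, inner ℝ ν w = -h * (b.coord i).linear w)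
    (hp : ContDiff ℝ 1 p) :
    ∫ x in convexHull ℝ (Set.range b), (finrank ℝ V * p x + fderiv ℝ p x (x - b i)) =
      h * ∫ y in convexHull ℝ (b '' {i}ᶜ), p y ∂μHE[finrank ℝ V - 1] := by
  rw [convexHull_range_eq_convexJoin b i]
  refine setIntegral_radial_cone hν hh ((Set.toFinite _).isCompact_convexHull ℝ) (fun x hx => ?_) hp
  have hx0 : b.coord i x = 0 := coord_eq_zero_of_mem_convexHull b
    (by rintro _ ⟨j, hj, rfl⟩; exact b.coord_apply_ne (Ne.symm hj)) hx
  rw [hνh, ← vsub_eq_sub, (b.coord i).linearMap_vsub, hx0, b.coord_apply_eq]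
  simp

theorem setIntegral_fderiv_simplex [Fintype ι] [Nontrivial ι] {ν : ι → V} {h : ι → ℝ}
    (hν : ∀ i, ‖ν i‖ = 1) (hh : ∀ i, 0 < h i)
    (hνh : ∀ i w, inner ℝ (ν i) w = -h i * (b.coord i).linear w) (hp : ContDiff ℝ 1 p) (w : V) :
    ∫ x in convexHull ℝ (Set.range b), fderiv ℝ p x w =
      ∑ i, inner ℝ (ν i) w * ∫ y in convexHull ℝ (b '' {i}ᶜ), p y ∂μHE[finrank ℝ V - 1] := by
  have hp' := hp.continuous
  have := hp.continuous_fderiv one_ne_zero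
  -- `w = ∑ᵢ λᵢ bᵢ` with `∑ᵢ λᵢ = 0`, so the derivative along `w` combines those along the `x - bᵢ`.
  have hw (x : V) : fderiv ℝ p x w = ∑ i, -(b.coord i).linear w *
      (finrank ℝ V * p x + fderiv ℝ p x (x - b i)) := by
    conv_lhs => rw [← sum_coord_linear_smul b w]
    simp only [map_sum, map_smul, map_sub, smul_eq_mul, neg_mul, mul_add, mul_sub,
      Finset.sum_neg_distrib, Finset.sum_add_distrib, Finset.sum_sub_distrib, ← Finset.sum_mul,
      sum_coord_linear]
    ring
  simp only [hw]
  rw [integral_finsetSum _ fun i _ => ContinuousOn.integrableOn_compact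
    ((Set.finite_range b).isCompact_convexHull ℝ) (by fun_prop)]
  refine Finset.sum_congr rfl fun i _ => ?_
  rw [integral_const_mul, setIntegral_radial_simplex b (hν i) (hh i) (hνh i) hp, hνh]
  ring

end Simplex

/-! ### Facets and normals of a conforming mesh -/

section Mesh

variable {d : ℕ} {Ω : Set (E d)}

theorem isCompact_convexHull_finset (s : Finset (E d)) : IsCompact (convexHull ℝ (s : Set (E d))) :=
  s.finite_toSet.isCompact_convexHull ℝ

/-- The relatively open simplex with vertex set `F`, as the set of convex combinations of its
vertices with positive weights. It depends on `F` only and not on a mesh element containing `F`,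
so that it can be compared with the barycentric coordinates of all elements adjacent to `F`. -/
def openFace (F : Finset (E d)) : Set (E d) :=
  {x | ∃ w : E d → ℝ, (∀ p ∈ F, 0 < w p) ∧ ∑ p ∈ F, w p = 1 ∧ ∑ p ∈ F, w p • p = x}

theorem openFace_nonempty {F : Finset (E d)} (hF : F.Nonempty) : (openFace F).Nonempty :=
  ⟨_, fun _ => (F.card : ℝ)⁻¹, fun _ _ => by have := hF.card_pos; positivity,
    by simp [hF.card_ne_zero], rfl⟩

theorem openFace_subset_convexHull (F : Finset (E d)) :
    openFace F ⊆ convexHull ℝ (F : Set (E d)) := by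
  rintro _ ⟨w, hw0, hw1, rfl⟩
  exact (convex_convexHull ℝ _).sum_mem (fun p hp => (hw0 p hp).le) hw1
    fun p hp => subset_convexHull ℝ _ hp

theorem convexHull_subset_closure_openFace (F : Finset (E d)) :
    convexHull ℝ (F : Set (E d)) ⊆ closure (openFace F) := by
  intro x hx
  obtain ⟨w, hw0, hw1, rfl⟩ := Finset.mem_convexHull'.1 hx
  obtain ⟨_, u, hu0, hu1, rfl⟩ := openFace_nonempty
    (F.coe_nonempty.1 (convexHull_nonempty_iff.1 ⟨_, hx⟩))
  have htend : Filter.Tendsto (fun s : ℝ => ∑ p ∈ F, ((1 - s) * w p + s * u p) • p) (𝓝[>] 0)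
      (𝓝 (∑ p ∈ F, w p • p)) :=
    tendsto_nhdsWithin_of_tendsto_nhds (Continuous.tendsto' (by fun_prop) _ _ (by simp))
  refine mem_closure_of_tendsto htend ?_
  filter_upwards [Ioo_mem_nhdsGT one_pos] with s hs
  refine ⟨fun p => (1 - s) * w p + s * u p, fun p hp => ?_, ?_, rfl⟩
  · exact add_pos_of_nonneg_of_pos (mul_nonneg (sub_nonneg.2 hs.2.le) (hw0 p hp))
      (mul_pos hs.1 (hu0 p hp))
  · rw [Finset.sum_add_distrib, ← Finset.mul_sum, ← Finset.mul_sum, hw1, hu1]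
    ring

variable {T : Triangulation d Ω} {K L : Cell T} {F : Finset (E d)} {x y : E d}

/-- The vertices of a mesh element as an affine basis; its coordinate functions are the barycentric
coordinates of the element. -/
def vertexBasis (T : Triangulation d Ω) (K : Cell T) : AffineBasis K.1 ℝ (E d) :=
  ⟨(↑), T.indep K.1 K.2, (T.indep K.1 K.2).affineSpan_eq_top_iff_card_eq_finrank_add_one.2
    (by simp [T.card_cell K.1 K.2])⟩

theorem coord_vertex_self (i : K.1) : (vertexBasis T K).coord i i = 1 :=
  (vertexBasis T K).coord_apply_eq i

theorem coord_vertex_ne {i : K.1} (hx : x ∈ K.1) (hxi : x ≠ i) :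
    (vertexBasis T K).coord i x = 0 :=
  (vertexBasis T K).coord_apply_ne (j := ⟨x, hx⟩) fun h => hxi (congrArg Subtype.val h.symm)

theorem range_vertexBasis (K : Cell T) : Set.range (vertexBasis T K) = (K.1 : Set (E d)) :=
  Subtype.range_coe

theorem mem_convexHull_iff_coord_nonneg :
    x ∈ convexHull ℝ (K.1 : Set (E d)) ↔ ∀ i, 0 ≤ (vertexBasis T K).coord i x := by
  rw [← range_vertexBasis, (vertexBasis T K).convexHull_eq_nonneg_coord, Set.mem_ofPred_eq]

theorem mem_openCell_iff_coord_pos :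
    x ∈ openCell T K ↔ ∀ i, 0 < (vertexBasis T K).coord i x := by
  rw [openCell, ← range_vertexBasis, (vertexBasis T K).interior_convexHull, Set.mem_ofPred_eq]

theorem coord_pos_of_mem_openFace (hx : x ∈ openFace F) (hF : F ⊆ K.1) {i : K.1}
    (hi : (i : E d) ∈ F) : 0 < (vertexBasis T K).coord i x := by
  obtain ⟨w, hw0, hw1, rfl⟩ := hx
  rw [coord_sum_smul _ _ _ _ hw1, Finset.sum_eq_single_of_mem _ hi
    fun p hp hpi => by rw [coord_vertex_ne (hF hp) hpi, mul_zero], coord_vertex_self, mul_one]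
  exact hw0 _ hi

theorem coord_eq_zero_of_notMem {s : Set (E d)} (hs : s ⊆ K.1) (hx : x ∈ convexHull ℝ s)
    {i : K.1} (hi : (i : E d) ∉ s) : (vertexBasis T K).coord i x = 0 :=
  coord_eq_zero_of_mem_convexHull _
    (fun _ hp => coord_vertex_ne (hs hp) (ne_of_mem_of_not_mem hp hi)) hx

theorem mem_of_coord_ne_zero (hK : x ∈ convexHull ℝ (K.1 : Set (E d)))
    (hL : x ∈ convexHull ℝ (L.1 : Set (E d))) {i : K.1} (hi : (vertexBasis T K).coord i x ≠ 0) :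
    (i : E d) ∈ L.1 := by
  by_contra hiL
  refine hi (coord_eq_zero_of_notMem Set.inter_subset_left ?_ fun h => hiL h.2)
  rw [← T.conforming K.1 K.2 L.1 L.2]
  exact ⟨hK, hL⟩

theorem disjoint_openCell (hKL : K ≠ L) : Disjoint (openCell T K) (openCell T L) := by
  refine Set.disjoint_left.2 fun x hxK hxL => hKL (Subtype.ext ?_)
  refine Finset.eq_of_subset_of_card_le (fun p hp => ?_)
    (T.card_cell L.1 L.2 ▸ (T.card_cell K.1 K.2).ge)
  exact mem_of_coord_ne_zero (interior_subset hxK) (interior_subset hxL)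
    (mem_openCell_iff_coord_pos.1 hxK ⟨p, hp⟩).ne'

theorem mem_facets : F ∈ facets T ↔ ∃ K : Cell T, F ⊆ K.1 ∧ F.card = d := by
  simp only [facets, Finset.mem_biUnion, Finset.mem_powersetCard, Subtype.exists, exists_prop]

theorem mem_adj : K ∈ adj T F ↔ F ⊆ K.1 := by
  simp only [adj, Finset.mem_filter_univ]

theorem card_of_mem_facets (hF : F ∈ facets T) : F.card = d :=
  (mem_facets.1 hF).choose_spec.2

theorem powersetCard_eq_image_erase {α : Type*} [DecidableEq α] {s : Finset α} {n : ℕ}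
    (hs : s.card = n + 1) : s.powersetCard n = s.image s.erase := by
  ext t
  rw [Finset.mem_powersetCard, Finset.mem_image]
  constructor
  · rintro ⟨hts, htn⟩
    obtain ⟨a, ha, rfl⟩ := Finset.exists_eq_insert_iff.2 ⟨hts, by rw [htn, hs]⟩
    exact ⟨a, Finset.mem_insert_self a t, Finset.erase_insert ha⟩
  · rintro ⟨a, ha, rfl⟩
    exact ⟨Finset.erase_subset a s, by rw [Finset.card_erase_of_mem ha, hs, Nat.add_sub_cancel]⟩

theorem image_vertexBasis_compl (K : Cell T) (a : K.1) :
    vertexBasis T K '' {a}ᶜ = (K.1.erase a : Set (E d)) := by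
  ext x
  rw [Finset.mem_coe, Finset.mem_erase]
  constructor
  · rintro ⟨j, hj, rfl⟩
    exact ⟨fun h => hj (Subtype.ext h), j.2⟩
  · rintro ⟨hxa, hxK⟩
    exact ⟨⟨x, hxK⟩, fun h => hxa (congrArg Subtype.val h), rfl⟩

theorem exists_erase_eq (hF : F ∈ facets T) (hK : K ∈ adj T F) : ∃ a : K.1, K.1.erase a = F := by
  have hFK := Finset.mem_powersetCard.2 ⟨mem_adj.1 hK, card_of_mem_facets hF⟩
  rw [powersetCard_eq_image_erase (T.card_cell K.1 K.2), Finset.mem_image] at hFK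
  obtain ⟨a, ha, rfl⟩ := hFK
  exact ⟨⟨a, ha⟩, rfl⟩

section Normal

variable [NeZero d]

instance nontrivial_vertices (K : Cell T) : Nontrivial K.1 :=
  Fintype.one_lt_card_iff_nontrivial.1 <| by
    rw [Fintype.card_coe, T.card_cell K.1 K.2]
    exact Nat.succ_lt_succ (NeZero.pos d)

theorem isOutwardNormal_erase_iff {a : K.1} {ν : E d} :
    IsOutwardNormal K.1 (K.1.erase a) ν ↔
      ‖ν‖ = 1 ∧ ∃ h > 0, ∀ w, inner ℝ ν w = -h * ((vertexBasis T K).coord a).linear w := by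
  have hmem {j : K.1} (hj : j ≠ a) : (j : E d) ∈ K.1.erase a :=
    Finset.mem_erase.2 ⟨fun h => hj (Subtype.ext h), j.2⟩
  have hcoord {p : E d} (hp : p ∈ K.1.erase a) : (vertexBasis T K).coord a p = 0 :=
    coord_vertex_ne (Finset.mem_of_mem_erase hp) (Finset.ne_of_mem_erase hp)
  refine and_congr_right fun _ => ⟨fun ⟨hflat, hneg⟩ => ?_, fun ⟨h, hh, hν⟩ => ?_⟩
  · obtain ⟨k, hk⟩ := exists_ne a
    refine ⟨-inner ℝ ν ((a : E d) - k),
      neg_pos.2 (hneg a a.2 (Finset.notMem_erase _ _) k (hmem hk)), fun w => ?_⟩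
    rw [neg_neg]
    exact inner_eq_mul_coord_linear (vertexBasis T K) (k := k)
      (fun j hj => hflat k (hmem hk) j (hmem hj)) w
  · have hsub (p q : E d) : inner ℝ ν (q - p) =
        -h * ((vertexBasis T K).coord a q - (vertexBasis T K).coord a p) := by
      rw [hν, ← vsub_eq_sub, AffineMap.linearMap_vsub, vsub_eq_sub]
    refine ⟨fun p hp q hq => ?_, fun r hr hrF p hp => ?_⟩
    · rw [hsub, hcoord hp, hcoord hq, sub_self, mul_zero]
    · obtain rfl : r = a := by_contra fun hra => hrF (Finset.mem_erase.2 ⟨hra, hr⟩)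
      rw [hsub, hcoord hp, coord_vertex_self, sub_zero, mul_one]
      exact neg_neg_of_pos hh

theorem isOutwardNormal_outwardNormal (hF : F ∈ facets T) (hK : K ∈ adj T F) :
    IsOutwardNormal K.1 F (outwardNormal K.1 F) := by
  obtain ⟨a, rfl⟩ := exists_erase_eq hF hK
  have hex : ∃ ν, IsOutwardNormal K.1 (K.1.erase a) ν :=
    (exists_norm_eq_one_inner_eq_neg_mul (coord_linear_ne_zero (vertexBasis T K) a)).imp
      fun _ => isOutwardNormal_erase_iff.2
  rw [outwardNormal, dif_pos hex]
  exact hex.choose_spec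

theorem norm_outwardNormal (hF : F ∈ facets T) (hK : K ∈ adj T F) : ‖outwardNormal K.1 F‖ = 1 :=
  (isOutwardNormal_outwardNormal hF hK).1

theorem exists_inner_outwardNormal_sub_eq (hF : F ∈ facets T) (hK : K ∈ adj T F) :
    ∃ a : K.1, K.1.erase a = F ∧ ∃ h > 0, ∀ x ∈ convexHull ℝ (F : Set (E d)), ∀ y,
      inner ℝ (outwardNormal K.1 F) (y - x) = -h * (vertexBasis T K).coord a y := by
  obtain ⟨a, rfl⟩ := exists_erase_eq hF hK
  obtain ⟨-, h, hh, hν⟩ := isOutwardNormal_erase_iff.1 (isOutwardNormal_outwardNormal hF hK)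
  refine ⟨a, rfl, h, hh, fun x hx y => ?_⟩
  rw [hν, ← vsub_eq_sub, AffineMap.linearMap_vsub,
    coord_eq_zero_of_notMem (mem_adj.1 hK) hx (by simp), vsub_eq_sub, sub_zero]

theorem inner_outwardNormal_sub_nonpos (hF : F ∈ facets T) (hK : K ∈ adj T F)
    (hx : x ∈ convexHull ℝ (F : Set (E d))) (hy : y ∈ convexHull ℝ (K.1 : Set (E d))) :
    inner ℝ (outwardNormal K.1 F) (y - x) ≤ 0 := by
  obtain ⟨a, -, h, hh, hν⟩ := exists_inner_outwardNormal_sub_eq hF hK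
  rw [hν x hx]
  exact mul_nonpos_of_nonpos_of_nonneg (neg_nonpos.2 hh.le) (mem_convexHull_iff_coord_nonneg.1 hy a)

theorem inner_outwardNormal_sub_eq_zero (hF : F ∈ facets T) (hK : K ∈ adj T F)
    (hx : x ∈ convexHull ℝ (F : Set (E d))) (hy : y ∈ convexHull ℝ (F : Set (E d))) :
    inner ℝ (outwardNormal K.1 F) (y - x) = 0 := by
  obtain ⟨a, -, h, -, hν⟩ := exists_inner_outwardNormal_sub_eq hF hK
  rw [hν x hx, ← hν y hy, sub_self, inner_zero_right]

theorem eventually_mem_openCell (hF : F ∈ facets T) (hK : K ∈ adj T F) (hx : x ∈ openFace F) :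
    ∀ᶠ y in 𝓝 x, inner ℝ (outwardNormal K.1 F) (y - x) < 0 → y ∈ openCell T K := by
  obtain ⟨a, ha, h, hh, hν⟩ := exists_inner_outwardNormal_sub_eq hF hK
  have hcoord : ∀ᶠ y in 𝓝 x, ∀ i ≠ a, 0 < (vertexBasis T K).coord i y := by
    refine Filter.eventually_all.2 fun i => Filter.eventually_imp_distrib_left.2 fun hi =>
      continuous_barycentric_coord (vertexBasis T K) i |>.continuousAt.eventually_const_lt ?_
    exact coord_pos_of_mem_openFace hx (mem_adj.1 hK)
      (ha ▸ Finset.mem_erase.2 ⟨fun h => hi (Subtype.ext h), i.2⟩)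
  filter_upwards [hcoord] with y hy hneg
  rw [hν x (openFace_subset_convexHull F hx)] at hneg
  refine mem_openCell_iff_coord_pos.2 fun i => ?_
  by_cases hi : i = a
  · rw [hi]
    exact pos_of_mul_neg_right hneg (neg_nonpos.2 hh.le)
  · exact hy i hi

theorem outwardNormal_eq_neg (hF : F ∈ facets T) (hK : K ∈ adj T F) (hL : L ∈ adj T F)
    (hKL : K ≠ L) : outwardNormal K.1 F = -outwardNormal L.1 F := by
  have hFne : F.Nonempty := Finset.card_pos.1 ((card_of_mem_facets hF).symm ▸ NeZero.pos d)
  obtain ⟨x, hx⟩ := openFace_nonempty hFne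
  have hνK := norm_outwardNormal hF hK
  have hνL := norm_outwardNormal hF hL
  by_contra hne
  -- Otherwise `-(ν_K + ν_L)` points into both elements.
  have hpos : 0 < 1 + inner ℝ (outwardNormal K.1 F) (outwardNormal L.1 F) := by
    have hge := neg_le_of_abs_le
      (abs_real_inner_le_norm (outwardNormal K.1 F) (outwardNormal L.1 F))
    have hne' := (inner_eq_neg_one_iff_of_norm_eq_one (𝕜 := ℝ) hνK hνL).not.2 hne
    rw [hνK, hνL, one_mul] at hge
    linarith [hge.lt_of_ne' hne']
  have htend : Filter.Tendsto
      (fun s : ℝ => x - s • (outwardNormal K.1 F + outwardNormal L.1 F)) (𝓝[>] 0) (𝓝 x) :=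
    tendsto_nhdsWithin_of_tendsto_nhds (Continuous.tendsto' (by fun_prop) _ _ (by simp))
  obtain ⟨s, ⟨hsK, hsL⟩, hs⟩ := ((htend.eventually ((eventually_mem_openCell hF hK hx).and
    (eventually_mem_openCell hF hL hx))).and self_mem_nhdsWithin).exists
  rw [sub_sub_cancel_left, inner_neg_right, inner_smul_right, inner_add_right,
    real_inner_self_eq_norm_sq, neg_neg_iff_pos] at hsK hsL
  rw [hνK, one_pow] at hsK
  rw [real_inner_comm, hνL, one_pow, add_comm] at hsL
  exact Set.disjoint_left.1 (disjoint_openCell hKL) (hsK (mul_pos hs hpos)) (hsL (mul_pos hs hpos))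

theorem card_adj_le_two (hF : F ∈ facets T) : (adj T F).card ≤ 2 := by
  by_contra! hcard
  obtain ⟨K, L, M, hK, hL, hM, hKL, hKM, hLM⟩ := Finset.two_lt_card_iff.1 hcard
  have hself : outwardNormal L.1 F = outwardNormal M.1 F := by
    rw [← neg_inj, ← outwardNormal_eq_neg hF hK hL hKL, outwardNormal_eq_neg hF hK hM hKM]
  have := IsAddTorsionFree.of_isTorsionFree ℝ (E d)
  have hzero : outwardNormal M.1 F = 0 :=
    self_eq_neg.1 (hself.symm.trans (outwardNormal_eq_neg hF hL hM hLM))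
  simpa [hzero] using norm_outwardNormal hF hM

theorem mem_frontier_of_mem_openFace (hF : F ∈ facets T)
    (hadj : adj T F = {K}) (hx : x ∈ openFace F) : x ∈ frontier Ω := by
  have hcover (y : E d) : y ∈ closure Ω ↔ ∃ L : Cell T, y ∈ convexHull ℝ (L.1 : Set (E d)) := by
    simp only [← T.cover, Set.mem_iUnion, Subtype.exists, exists_prop]
  have hK : K ∈ adj T F := by simp [hadj]
  have hxF := openFace_subset_convexHull F hx
  have hxK := convexHull_mono (mem_adj.1 hK) hxF
  rw [frontier, Set.mem_sdiff, hcover]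
  refine ⟨⟨K, hxK⟩, fun hint => ?_⟩
  -- Only `K` contains `x`, so `Ω` would coincide with `K` near `x`.
  have honly (L : Cell T) (hLK : L ≠ K) : ∀ᶠ y in 𝓝 x, y ∉ convexHull ℝ (L.1 : Set (E d)) := by
    refine (isCompact_convexHull_finset L.1).isClosed.isOpen_compl.mem_nhds fun hxL => hLK ?_
    rw [← Finset.mem_singleton, ← hadj, mem_adj]
    exact fun p hp => mem_of_coord_ne_zero hxK hxL (i := ⟨p, mem_adj.1 hK hp⟩)
      (coord_pos_of_mem_openFace hx (mem_adj.1 hK) hp).ne'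
  have hnear : ∀ᶠ y in 𝓝 x, y ∈ convexHull ℝ (K.1 : Set (E d)) := by
    filter_upwards [isOpen_interior.mem_nhds hint,
      Filter.eventually_all.2 fun L => Filter.eventually_imp_distrib_left.2 (honly L)] with y hy hyL
    obtain ⟨L, hL⟩ := (hcover y).1 (subset_closure (interior_subset hy))
    by_cases hLK : L = K
    · rwa [hLK] at hL
    · exact absurd hL (hyL L hLK)
  have htend : Filter.Tendsto (fun s : ℝ => x + s • outwardNormal K.1 F) (𝓝[>] 0) (𝓝 x) :=
    tendsto_nhdsWithin_of_tendsto_nhds (Continuous.tendsto' (by fun_prop) _ _ (by simp))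
  obtain ⟨s, hsK, hs⟩ := ((htend.eventually hnear).and self_mem_nhdsWithin).exists
  have hle := inner_outwardNormal_sub_nonpos hF hK hxF hsK
  rw [add_sub_cancel_left, inner_smul_right, real_inner_self_eq_norm_sq,
    norm_outwardNormal hF hK] at hle
  linarith [show 0 < s from hs]

theorem mem_boundaryFacets_of_notMem_interfaces (hF : F ∈ facets T) (hF' : F ∉ interfaces T) :
    F ∈ boundaryFacets T := by
  obtain ⟨K, hFK, -⟩ := mem_facets.1 hF
  have hK : K ∈ adj T F := mem_adj.2 hFK
  have hne : (adj T F).card ≠ 2 := fun h => hF' (by simp [interfaces, hF, h])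
  have hle : (adj T F).card ≤ 1 := Nat.le_of_lt_succ ((card_adj_le_two hF).lt_of_ne hne)
  have hadj : adj T F = {K} :=
    Finset.eq_singleton_iff_unique_mem.2 ⟨hK, fun L hL => Finset.card_le_one.1 hle L hL K hK⟩
  simp only [boundaryFacets, Finset.mem_filter]
  exact ⟨hF, (convexHull_subset_closure_openFace F).trans
    (closure_minimal (fun x => mem_frontier_of_mem_openFace hF hadj) isClosed_frontier)⟩

end Normal

end Mesh

/-! ### Broken polynomials as functions -/

section BrokenPolynomial

variable {d : ℕ} {Ω : Set (E d)} {T : Triangulation d Ω}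

theorem contDiff_ev (p : BPoly T) (K : Cell T) {n : WithTop ℕ∞} : ContDiff ℝ n (ev p K) := by
  unfold ev
  induction p K using MvPolynomial.induction_on with
  | C a => simpa only [MvPolynomial.eval_C] using contDiff_const
  | add p q hp hq => simpa only [map_add] using hp.add hq
  | mul_X p i hp =>
    simp only [map_mul, MvPolynomial.eval_X]
    exact hp.mul (EuclideanSpace.proj (𝕜 := ℝ) i).contDiff

@[fun_prop] theorem continuous_ev (p : BPoly T) (K : Cell T) : Continuous (ev p K) :=
  (contDiff_ev p K).continuous (n := 0)

@[simp] theorem ev_add (p q : BPoly T) (K : Cell T) (x : E d) :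
    ev (p + q) K x = ev p K x + ev q K x :=
  map_add _ _ _

@[simp] theorem ev_sub (p q : BPoly T) (K : Cell T) (x : E d) :
    ev (p - q) K x = ev p K x - ev q K x :=
  map_sub _ _ _

@[simp] theorem ev_mul (p q : BPoly T) (K : Cell T) (x : E d) :
    ev (p * q) K x = ev p K x * ev q K x :=
  map_mul _ _ _

@[simp] theorem ev_one (K : Cell T) (x : E d) : ev (1 : BPoly T) K x = 1 :=
  map_one _

@[simp] theorem ev_smul (c : ℝ) (p : BPoly T) (K : Cell T) (x : E d) :
    ev (c • p) K x = c * ev p K x :=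
  MvPolynomial.smul_eval _ _ _

@[simp] theorem ev_sum {ι : Type*} (s : Finset ι) (p : ι → BPoly T) (K : Cell T) (x : E d) :
    ev (∑ i ∈ s, p i) K x = ∑ i ∈ s, ev (p i) K x := by
  simp only [ev, Finset.sum_apply, map_sum]

@[simp] theorem D_mul (i : Fin d) (p q : BPoly T) : D i (p * q) = p * D i q + q * D i p :=
  funext fun _ => Derivation.leibniz _ _ _

@[simp] theorem D_sub (i : Fin d) (p q : BPoly T) : D i (p - q) = D i p - D i q :=
  funext fun _ => map_sub _ _ _

@[simp] theorem D_sum {ι : Type*} (i : Fin d) (s : Finset ι) (p : ι → BPoly T) :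
    D i (∑ j ∈ s, p j) = ∑ j ∈ s, D i (p j) :=
  funext fun K => by simp only [D, Finset.sum_apply, map_sum]

theorem fderiv_ev_single (p : BPoly T) (K : Cell T) (x : E d) (i : Fin d) :
    fderiv ℝ (ev p K) x (EuclideanSpace.single i 1) = ev (D i p) K x := by
  have hdiff (q : MvPolynomial (Fin d) ℝ) :
      DifferentiableAt ℝ (fun y : E d => q.eval fun j => y j) x :=
    (contDiff_ev (fun _ => q) K).differentiable (n := 1) one_ne_zero x
  unfold ev D
  induction p K using MvPolynomial.induction_on with
  | C a =>
    simp only [MvPolynomial.eval_C, fderiv_const_apply, zero_apply, MvPolynomial.pderiv_C, map_zero]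
  | add p q hp hq =>
    simp only [map_add, ← hp, ← hq]
    rw [fderiv_fun_add (hdiff p) (hdiff q), add_apply]
  | mul_X p j hp =>
    have hX : HasFDerivAt (fun y : E d => y j) (EuclideanSpace.proj j : E d →L[ℝ] ℝ) x :=
      (EuclideanSpace.proj j : E d →L[ℝ] ℝ).hasFDerivAt
    simp only [map_mul, MvPolynomial.eval_X]
    rw [fderiv_fun_mul (hdiff p) hX.differentiableAt, hX.fderiv]
    simp [Derivation.leibniz, MvPolynomial.pderiv_X, hp, Pi.single_apply, apply_ite]

@[simp] theorem ev_divg (u : Fin d → BPoly T) (K : Cell T) (x : E d) :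
    ev (divg u) K x = ∑ i, ev (D i (u i)) K x :=
  ev_sum _ _ _ _

theorem ev_divg_mul (p : BPoly T) (u : Fin d → BPoly T) (K : Cell T) (x : E d) :
    ev (divg fun i => p * u i) K x =
      ev p K x * ev (divg u) K x + ∑ i, ev (D i p) K x * ev (u i) K x := by
  simp only [ev_divg, D_mul, ev_add, ev_mul, Finset.sum_add_distrib, Finset.mul_sum, mul_comm]

end BrokenPolynomial

/-! ### Integrals of broken functions -/

section BrokenIntegral

variable {d : ℕ} {Ω : Set (E d)} {T : Triangulation d Ω} {f g : Cell T → E d → ℝ}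

theorem openCell_ae_eq (K : Cell T) :
    openCell T K =ᵐ[volume] convexHull ℝ (K.1 : Set (E d)) :=
  interior_ae_eq_of_null_frontier ((convex_convexHull ℝ _).addHaar_frontier _)

theorem isCompact_closure_domain (T : Triangulation d Ω) : IsCompact (closure Ω) := by
  rw [← T.cover]
  exact T.cells.isCompact_biUnion fun K _ => isCompact_convexHull_finset K

theorem ae_eq_iUnion_openCell (T : Triangulation d Ω) (hΩ : interior (closure Ω) = Ω) :
    Ω =ᵐ[volume] ⋃ K : Cell T, openCell T K := by
  have hcover : closure Ω = ⋃ K : Cell T, convexHull ℝ (K.1 : Set (E d)) := by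
    rw [← T.cover, Set.iUnion_subtype]
  have hsub : ⋃ K : Cell T, openCell T K ⊆ Ω := by
    refine Set.Subset.trans (Set.iUnion_subset fun K => interior_mono ?_) hΩ.le
    rw [hcover]
    exact Set.subset_iUnion (fun K : Cell T => convexHull ℝ (K.1 : Set (E d))) K
  refine Filter.EventuallyLE.antisymm ?_ hsub.eventuallyLE
  refine subset_closure.eventuallyLE.trans (Filter.EventuallyEq.symm ?_).le
  rw [hcover]
  exact Filter.EventuallyEq.countable_iUnion openCell_ae_eq

theorem volInt_eq_setIntegral (T : Triangulation d Ω) (hΩ : interior (closure Ω) = Ω)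
    {f : E d → ℝ} (hf : IntegrableOn f Ω) : volInt T (fun _ => f) = ∫ x in Ω, f x := by
  rw [volInt, setIntegral_congr_set (ae_eq_iUnion_openCell T hΩ), integral_iUnion_fintype]
  · exact fun K => isOpen_interior.measurableSet
  · exact fun K L => disjoint_openCell
  · exact fun K => (hf.congr_set_ae (ae_eq_iUnion_openCell T hΩ).symm).mono_set
      (Set.subset_iUnion (openCell T) K)

/-- Integrability of a broken function over every mesh element, so that `volInt` is additive. -/
def BrokenIntegrable (T : Triangulation d Ω) (f : Cell T → E d → ℝ) : Prop :=
  ∀ K, IntegrableOn (f K) (openCell T K)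

theorem brokenIntegrable_of_continuous (hf : ∀ K, Continuous (f K)) : BrokenIntegrable T f :=
  fun K => ((hf K).continuousOn.integrableOn_compact
    (isCompact_convexHull_finset K.1)).mono_set interior_subset

theorem brokenIntegrable_of_memLp_two
    (hf : ∀ K, MemLp (f K) 2 (volume.restrict (openCell T K))) : BrokenIntegrable T f := fun K =>
  have : IsFiniteMeasure (volume.restrict (openCell T K)) :=
    isFiniteMeasure_restrict.2 (measure_mono interior_subset |>.trans_lt
      (isCompact_convexHull_finset K.1).measure_lt_top).ne
  (hf K).integrable one_le_two

namespace BrokenIntegrable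

theorem add (hf : BrokenIntegrable T f) (hg : BrokenIntegrable T g) :
    BrokenIntegrable T fun K x => f K x + g K x :=
  fun K => (hf K).add (hg K)

theorem sub (hf : BrokenIntegrable T f) (hg : BrokenIntegrable T g) :
    BrokenIntegrable T fun K x => f K x - g K x :=
  fun K => (hf K).sub (hg K)

theorem const_mul (hf : BrokenIntegrable T f) (c : ℝ) : BrokenIntegrable T fun K x => c * f K x :=
  fun K => (hf K).const_mul c

theorem mul_continuous (hf : BrokenIntegrable T f) (hg : ∀ K, Continuous (g K)) :
    BrokenIntegrable T fun K x => f K x * g K x := fun K =>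
  (((hf K).congr_set_ae (openCell_ae_eq K).symm).mul_continuousOn (hg K).continuousOn
    (isCompact_convexHull_finset K.1)).mono_set interior_subset

end BrokenIntegrable

theorem volInt_add (hf : BrokenIntegrable T f) (hg : BrokenIntegrable T g) :
    volInt T (fun K x => f K x + g K x) = volInt T f + volInt T g := by
  simp only [volInt, ← Finset.sum_add_distrib]
  exact Finset.sum_congr rfl fun K _ => integral_add (hf K) (hg K)

theorem volInt_sub (hf : BrokenIntegrable T f) (hg : BrokenIntegrable T g) :
    volInt T (fun K x => f K x - g K x) = volInt T f - volInt T g := by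
  simp only [volInt, ← Finset.sum_sub_distrib]
  exact Finset.sum_congr rfl fun K _ => integral_sub (hf K) (hg K)

theorem volInt_const_mul (c : ℝ) (f : Cell T → E d → ℝ) :
    volInt T (fun K x => c * f K x) = c * volInt T f := by
  simp only [volInt, Finset.mul_sum, integral_const_mul]

end BrokenIntegral

/-! ### Interfaces -/

section Interface

variable {d : ℕ} {Ω : Set (E d)} {T : Triangulation d Ω} {F : Finset (E d)}

theorem mem_facets_of_mem_interfaces (hF : F ∈ interfaces T) : F ∈ facets T :=
  (Finset.mem_filter.1 hF).1

theorem card_adj_of_mem_interfaces (hF : F ∈ interfaces T) : (adj T F).card = 2 :=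
  (Finset.mem_filter.1 hF).2

theorem interfaceInt_congr {f g : Finset (E d) → E d → ℝ}
    (h : ∀ F ∈ interfaces T, ∀ x, f F x = g F x) : interfaceInt T f = interfaceInt T g :=
  Finset.sum_congr rfl fun F hF => congrArg (facetInt F) (funext (h F hF))

theorem interfaceInt_const_mul (c : ℝ) (f : Finset (E d) → E d → ℝ) :
    interfaceInt T (fun F x => c * f F x) = c * interfaceInt T f := by
  simp only [interfaceInt, facetInt, Finset.mul_sum, integral_const_mul]

theorem avg_one (hF : F ∈ interfaces T) (x : E d) : avg T F (ev (1 : BPoly T)) x = 1 := by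
  simp [avg, card_adj_of_mem_interfaces hF]

theorem jump_sub (p q : BPoly T) (x : E d) :
    jump T F (ev (p - q)) x = jump T F (ev p) x - jump T F (ev q) x := by
  ext i
  simp only [jump, ev_sub, sub_mul, Finset.sum_sub_distrib, Pi.sub_apply]

theorem continuous_evVec (u : Fin d → BPoly T) (K : Cell T) : Continuous (evVec u K) :=
  continuous_pi fun i => continuous_ev (u i) K

theorem continuous_avg {M : Type} [AddCommGroup M] [Module ℝ M] [TopologicalSpace M]
    [ContinuousAdd M] [ContinuousConstSMul ℝ M] {g : Cell T → E d → M}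
    (hg : ∀ K, Continuous (g K)) : Continuous (avg T F g) :=
  (continuous_finsetSum _ fun K _ => hg K).const_smul _

theorem continuous_jump (p : BPoly T) : Continuous (jump T F (ev p)) :=
  continuous_pi fun _ => continuous_finsetSum _ fun K _ => (continuous_ev p K).mul_const _

theorem continuous_jumpVec (u : Fin d → BPoly T) : Continuous (jumpVec T F (evVec u)) :=
  continuous_finsetSum _ fun K _ => continuous_finsetSum _ fun i _ =>
    (continuous_ev (u i) K).mul_const _

theorem continuous_jump_dotProduct_avg (p : BPoly T) (u : Fin d → BPoly T) :
    Continuous fun x => jump T F (ev p) x ⬝ᵥ avg T F (evVec u) x :=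
  (continuous_jump p).dotProduct (continuous_avg (continuous_evVec u))

theorem continuous_jumpVec_mul_avg (u : Fin d → BPoly T) (p : BPoly T) :
    Continuous fun x => jumpVec T F (evVec u) x * avg T F (ev p) x :=
  (continuous_jumpVec u).mul (continuous_avg (continuous_ev p))

variable [NeZero d]

theorem integrableOn_facet (hF : F ∈ facets T) {g : E d → ℝ} (hg : Continuous g) :
    IntegrableOn g (convexHull ℝ (F : Set (E d))) μHE[d - 1] := by
  obtain ⟨K, hFK, hcard⟩ := mem_facets.1 hF
  have hK : K ∈ adj T F := mem_adj.2 hFK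
  obtain ⟨p, hp⟩ : F.Nonempty := Finset.card_pos.1 (hcard.symm ▸ NeZero.pos d)
  have hFc := isCompact_convexHull_finset F
  have hlt := euclideanHausdorffMeasure_lt_top_of_isCompact (norm_outwardNormal hF hK) hFc
    fun x hx => inner_outwardNormal_sub_eq_zero hF hK (subset_convexHull ℝ _ hp) hx
  rw [finrank_euclideanSpace_fin] at hlt
  obtain ⟨C, hC⟩ := hFc.exists_bound_of_continuousOn hg.continuousOn
  exact Measure.integrableOn_of_bounded hlt.ne hg.aestronglyMeasurable
    (ae_restrict_of_forall_mem hFc.measurableSet hC)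

theorem interfaceInt_add {f g : Finset (E d) → E d → ℝ} (hf : ∀ F, Continuous (f F))
    (hg : ∀ F, Continuous (g F)) :
    interfaceInt T (fun F x => f F x + g F x) = interfaceInt T f + interfaceInt T g := by
  simp only [interfaceInt, ← Finset.sum_add_distrib]
  exact Finset.sum_congr rfl fun F hF =>
    integral_add (integrableOn_facet (mem_facets_of_mem_interfaces hF) (hf F))
      (integrableOn_facet (mem_facets_of_mem_interfaces hF) (hg F))

theorem interfaceInt_sub {f g : Finset (E d) → E d → ℝ} (hf : ∀ F, Continuous (f F))
    (hg : ∀ F, Continuous (g F)) :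
    interfaceInt T (fun F x => f F x - g F x) = interfaceInt T f - interfaceInt T g := by
  simp only [interfaceInt, ← Finset.sum_sub_distrib]
  exact Finset.sum_congr rfl fun F hF =>
    integral_sub (integrableOn_facet (mem_facets_of_mem_interfaces hF) (hf F))
      (integrableOn_facet (mem_facets_of_mem_interfaces hF) (hg F))

end Interface

/-! ### Elementwise integration by parts -/

section IntegrationByParts

variable {d : ℕ} {Ω : Set (E d)} {T : Triangulation d Ω}

/-- The vector field `u` has zero normal trace on `∂Ω`. -/
def HasZeroNormalTrace (u : Fin d → BPoly T) : Prop :=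
  ∀ F ∈ boundaryFacets T, ∀ K ∈ adj T F, ∀ x ∈ convexHull ℝ (F : Set (E d)),
    ∑ i, ev (u i) K x * outwardNormal K.1 F i = 0

theorem HasZeroNormalTrace.mul {u : Fin d → BPoly T} (hu : HasZeroNormalTrace u) (p : BPoly T) :
    HasZeroNormalTrace fun i => p * u i := fun F hF K hK x hx => by
  simp only [ev_mul, mul_assoc, ← Finset.mul_sum, hu F hF K hK x hx, mul_zero]

/-- The discrete gradient pairing `∫_Ω ∇p · u dx - ∫_𝓔 [p] · {u} ds`. -/
def gradForm (p : BPoly T) (u : Fin d → BPoly T) : ℝ :=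
  volInt T (fun K x => ∑ i, ev (D i p) K x * ev (u i) K x)
    - interfaceInt T (fun F x => jump T F (ev p) x ⬝ᵥ avg T F (evVec u) x)

/-- The discrete divergence pairing `∫_Ω div(u) p dx - ∫_𝓔 [u] {p} ds`. -/
def divForm (u : Fin d → BPoly T) (p : BPoly T) : ℝ :=
  volInt T (fun K x => ev (divg u) K x * ev p K x)
    - interfaceInt T (fun F x => jumpVec T F (evVec u) x * avg T F (ev p) x)

variable [NeZero d]

theorem gradForm_sub (p q : BPoly T) (u : Fin d → BPoly T) :
    gradForm (p - q) u = gradForm p u - gradForm q u := by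
  have hcont (r : BPoly T) :
      BrokenIntegrable T fun K x => ∑ i, ev (D i r) K x * ev (u i) K x :=
    brokenIntegrable_of_continuous fun K => continuous_finsetSum _ fun i _ =>
      (continuous_ev _ K).mul (continuous_ev _ K)
  simp only [gradForm, D_sub, ev_sub, jump_sub, sub_mul, Finset.sum_sub_distrib, sub_dotProduct]
  rw [volInt_sub (hcont p) (hcont q), interfaceInt_sub
    (fun _ => continuous_jump_dotProduct_avg p u) fun _ => continuous_jump_dotProduct_avg q u]
  ring

theorem setIntegral_D (p : BPoly T) (K : Cell T) (i : Fin d) :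
    ∫ x in openCell T K, ev (D i p) K x =
      ∑ F ∈ K.1.powersetCard d, outwardNormal K.1 F i * facetInt F (ev p K) := by
  have hfacet (a : K.1) : K.1.erase a ∈ K.1.powersetCard d := by
    rw [powersetCard_eq_image_erase (T.card_cell K.1 K.2)]
    exact Finset.mem_image_of_mem _ a.2
  have hnormal (a : K.1) := isOutwardNormal_erase_iff.1 (isOutwardNormal_outwardNormal
    (mem_facets.2 ⟨K, Finset.mem_powersetCard.1 (hfacet a)⟩)
    (mem_adj.2 (Finset.erase_subset (a : E d) K.1)))
  choose hnorm h hpos hinner using hnormal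
  have hgauss := setIntegral_fderiv_simplex (vertexBasis T K) hnorm hpos hinner
    (contDiff_ev p K) (EuclideanSpace.single i 1)
  simp only [fderiv_ev_single, EuclideanSpace.inner_single_right, range_vertexBasis,
    image_vertexBasis_compl, finrank_euclideanSpace_fin, one_mul, starRingEnd_apply, star_trivial]
    at hgauss
  rw [setIntegral_congr_set (openCell_ae_eq K), hgauss,
    powersetCard_eq_image_erase (T.card_cell K.1 K.2), Finset.sum_image (Finset.erase_injOn K.1)]
  exact Finset.sum_coe_sort K.1
    fun a => outwardNormal K.1 (K.1.erase a) i * facetInt (K.1.erase a) (ev p K)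

theorem setIntegral_divg (u : Fin d → BPoly T) (K : Cell T) :
    ∫ x in openCell T K, ev (divg u) K x = ∑ F ∈ K.1.powersetCard d,
      facetInt F fun x => ∑ i, ev (u i) K x * outwardNormal K.1 F i := by
  simp only [ev_divg]
  rw [integral_finsetSum _ fun i _ =>
    brokenIntegrable_of_continuous (continuous_ev (D i (u i))) K]
  simp only [setIntegral_D]
  rw [Finset.sum_comm]
  refine Finset.sum_congr rfl fun F hF => ?_
  have hF' : F ∈ facets T := mem_facets.2 ⟨K, Finset.mem_powersetCard.1 hF⟩
  rw [facetInt, integral_finsetSum _ fun i _ =>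
    integrableOn_facet hF' ((continuous_ev (u i) K).mul_const _)]
  simp only [integral_mul_const, facetInt, mul_comm]

theorem volInt_divg_eq_sum_facets (u : Fin d → BPoly T) :
    volInt T (ev (divg u)) = ∑ F ∈ facets T, facetInt F (jumpVec T F (evVec u)) := by
  simp only [volInt, setIntegral_divg]
  rw [Finset.sum_comm' (t' := facets T) (s' := adj T)]
  · refine Finset.sum_congr rfl fun F hF => (integral_finsetSum _ fun K _ => ?_).symm
    exact integrableOn_facet hF (continuous_finsetSum _ fun i _ =>
      (continuous_ev (u i) K).mul_const _)
  · intro K F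
    simp only [Finset.mem_univ, true_and, Finset.mem_powersetCard, mem_adj, mem_facets]
    exact ⟨fun h => ⟨h.1, K, h⟩, fun h => ⟨h.1, h.2.choose_spec.2⟩⟩

theorem volInt_divg {u : Fin d → BPoly T} (hu : HasZeroNormalTrace u) :
    volInt T (ev (divg u)) = interfaceInt T fun F => jumpVec T F (evVec u) := by
  rw [volInt_divg_eq_sum_facets]
  refine (Finset.sum_subset (fun F => mem_facets_of_mem_interfaces) fun F hF hF' => ?_).symm
  refine setIntegral_eq_zero_of_forall_eq_zero fun x hx => Finset.sum_eq_zero fun K hK => ?_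
  exact hu F (mem_boundaryFacets_of_notMem_interfaces hF hF') K hK x hx

theorem jumpVec_mul {F : Finset (E d)} (hF : F ∈ interfaces T) (p : BPoly T)
    (u : Fin d → BPoly T) (x : E d) :
    jumpVec T F (evVec fun i => p * u i) x =
      jump T F (ev p) x ⬝ᵥ avg T F (evVec u) x + jumpVec T F (evVec u) x * avg T F (ev p) x := by
  classical
  obtain ⟨K, L, hKL, hadj⟩ := Finset.card_eq_two.1 (card_adj_of_mem_interfaces hF)
  have hnormal : outwardNormal K.1 F = -outwardNormal L.1 F :=
    outwardNormal_eq_neg (mem_facets_of_mem_interfaces hF) (by simp [hadj]) (by simp [hadj]) hKL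
  simp only [jumpVec, jump, avg, evVec, dotProduct, hadj, Finset.card_pair hKL,
    Finset.sum_pair hKL, hnormal, ev_mul, PiLp.neg_apply, Pi.smul_apply, Pi.add_apply, smul_eq_mul,
    Nat.cast_ofNat]
  rw [← Finset.sum_add_distrib, ← Finset.sum_add_distrib, Finset.sum_mul, ← Finset.sum_add_distrib]
  exact Finset.sum_congr rfl fun i _ => by ring

theorem gradForm_eq_neg_divForm (p : BPoly T) {u : Fin d → BPoly T} (hu : HasZeroNormalTrace u) :
    gradForm p u = -divForm u p := by
  have hvol := volInt_divg (hu.mul p)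
  rw [interfaceInt_congr fun F hF => jumpVec_mul hF p u, interfaceInt_add
    (fun _ => continuous_jump_dotProduct_avg p u) fun _ => continuous_jumpVec_mul_avg u p] at hvol
  have hleibniz : volInt T (ev (divg fun i => p * u i)) =
      volInt T (fun K x => ev (divg u) K x * ev p K x) +
        volInt T (fun K x => ∑ i, ev (D i p) K x * ev (u i) K x) := by
    rw [← volInt_add]
    · exact congrArg (volInt T) (funext₂ fun K x => by rw [ev_divg_mul, mul_comm (ev p K x)])
    · exact brokenIntegrable_of_continuous fun K => (continuous_ev _ K).mul (continuous_ev p K)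
    · exact brokenIntegrable_of_continuous fun K => continuous_finsetSum _ fun i _ =>
        (continuous_ev _ K).mul (continuous_ev _ K)
  rw [gradForm, divForm]
  linear_combination hvol - hleibniz

theorem divForm_one {u : Fin d → BPoly T} (hu : HasZeroNormalTrace u) : divForm u 1 = 0 := by
  simp only [divForm, ev_one, mul_one]
  exact sub_eq_zero.2 ((volInt_divg hu).trans
    (interfaceInt_congr fun F hF x => by rw [avg_one hF, mul_one]))

end IntegrationByParts

/-! ### The discrete spaces -/

section Spaces

variable {d : ℕ} {Ω : Set (E d)} {T : Triangulation d Ω} {k : ℕ} {p q : BPoly T}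
  {u v : Fin d → BPoly T} {U V : State T}

theorem one_mem_Vh : (1 : BPoly T) ∈ Vh T k :=
  fun _ => MvPolynomial.totalDegree_one.trans_le (Nat.zero_le k)

theorem add_mem_Vh (hp : p ∈ Vh T k) (hq : q ∈ Vh T k) : p + q ∈ Vh T k :=
  fun K => (MvPolynomial.totalDegree_add _ _).trans (max_le (hp K) (hq K))

theorem sub_mem_Vh (hp : p ∈ Vh T k) (hq : q ∈ Vh T k) : p - q ∈ Vh T k :=
  fun K => (MvPolynomial.totalDegree_sub _ _).trans (max_le (hp K) (hq K))

theorem smul_mem_Vh (c : ℝ) (hp : p ∈ Vh T k) : c • p ∈ Vh T k :=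
  fun K => (MvPolynomial.totalDegree_smul_le _ _).trans (hp K)

theorem smul_add_mem_VhZero (c : ℝ) (hu : u ∈ VhZero T k) (hv : v ∈ VhZero T k) :
    c • (u + v) ∈ VhZero T k := by
  refine ⟨fun i => smul_mem_Vh c (add_mem_Vh (hu.1 i) (hv.1 i)), fun F hF K hK x hx i => ?_⟩
  rw [Pi.smul_apply, Pi.add_apply, ev_smul, ev_add, hu.2 F hF K hK x hx i, hv.2 F hF K hK x hx i,
    add_zero, mul_zero]

theorem smul_add_mem_VhNormal (c : ℝ) (hu : u ∈ VhNormal T k) (hv : v ∈ VhNormal T k) :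
    c • (u + v) ∈ VhNormal T k := by
  refine ⟨fun i => smul_mem_Vh c (add_mem_Vh (hu.1 i) (hv.1 i)), fun F hF K hK x hx => ?_⟩
  simp only [Pi.smul_apply, Pi.add_apply, ev_smul, ev_add, mul_assoc, add_mul, ← Finset.mul_sum,
    Finset.sum_add_distrib, hu.2 F hF K hK x hx, hv.2 F hF K hK x hx, add_zero, mul_zero]

theorem mid_mem_StateSpace (hU : U ∈ StateSpace T k) (hV : V ∈ StateSpace T k) :
    mid U V ∈ StateSpace T k := by
  obtain ⟨hUρ, hUv, hUφ, hUμ, hUτ, hUσ⟩ := hU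
  obtain ⟨hVρ, hVv, hVφ, hVμ, hVτ, hVσ⟩ := hV
  exact ⟨smul_mem_Vh _ (add_mem_Vh hUρ hVρ), smul_add_mem_VhZero _ hUv hVv,
    smul_mem_Vh _ (add_mem_Vh hUφ hVφ), smul_mem_Vh _ (add_mem_Vh hUμ hVμ),
    smul_mem_Vh _ (add_mem_Vh hUτ hVτ), smul_add_mem_VhNormal _ hUσ hVσ⟩

theorem hasZeroNormalTrace_of_mem_VhZero (hv : v ∈ VhZero T k) : HasZeroNormalTrace v :=
  fun F hF K hK x hx => Finset.sum_eq_zero fun i _ => by rw [hv.2 F hF K hK x hx i, zero_mul]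

theorem IsProjScalar.volInt_eq (hΩ : interior (closure Ω) = Ω) {f : E d → ℝ}
    (hf : IntegrableOn f Ω) (hp : IsProjScalar T k f p) : volInt T (ev p) = ∫ x in Ω, f x := by
  rw [← volInt_eq_setIntegral T hΩ hf]
  simpa only [ev_one, mul_one] using hp 1 one_mem_Vh

end Spaces

/-! ### Pointwise identities -/

section Pointwise

variable {d : ℕ} {Ω : Set (E d)} {T : Triangulation d Ω}

theorem Params.dens_sub_dens (P : Params) (r₀ p₀ r₁ p₁ : ℝ) :
    P.dens r₁ p₁ - P.dens r₀ p₀ =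
      P.dqPhi r₀ p₀ r₁ p₁ * (p₁ - p₀) + P.dqRho r₀ p₀ r₁ p₁ * (r₁ - r₀) := by
  have hφ₁ := sub_smul_dslope (fun p => P.dens r₁ p) p₀ p₁
  have hφ₀ := sub_smul_dslope (fun p => P.dens r₀ p) p₀ p₁
  have hρ₁ := sub_smul_dslope (fun r => P.dens r p₁) r₀ r₁
  have hρ₀ := sub_smul_dslope (fun r => P.dens r p₀) r₀ r₁
  simp only [smul_eq_mul] at hφ₁ hφ₀ hρ₁ hρ₀
  rw [Params.dqPhi, Params.dqRho]
  linear_combination (-1 / 2) * (hφ₁ + hφ₀ + hρ₁ + hρ₀)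

theorem sum_sub_mul_ev_midpoint (u₀ u₁ : Fin d → BPoly T) (K : Cell T) (x : E d) :
    ∑ i, (ev (u₁ i) K x - ev (u₀ i) K x) * ev (((1 / 2 : ℝ) • (u₀ + u₁)) i) K x =
      1 / 2 * (evVec u₁ K x ⬝ᵥ evVec u₁ K x - evVec u₀ K x ⬝ᵥ evVec u₀ K x) := by
  simp only [dotProduct, evVec, ← Finset.sum_sub_distrib, Finset.mul_sum]
  refine Finset.sum_congr rfl fun i _ => ?_
  rw [Pi.smul_apply, Pi.add_apply, ev_smul, ev_add]
  ring

theorem convection_dotProduct_self (ρ : BPoly T) (v : Fin d → BPoly T) (K : Cell T) (x : E d) :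
    ∑ i, (ev (divg fun j => ρ * v i * v j) K x - ev (divg fun j => ρ * v j) K x * ev (v i) K x
      - 1 / 2 * ev ρ K x * ev (D i (∑ j, v j * v j)) K x) * ev (v i) K x = 0 := by
  have hskew (i : Fin d) :
      (ev (divg fun j => ρ * v i * v j) K x - ev (divg fun j => ρ * v j) K x * ev (v i) K x
        - 1 / 2 * ev ρ K x * ev (D i (∑ j, v j * v j)) K x) * ev (v i) K x =
      ∑ j, ev ρ K x * ev (v j) K x * ev (D j (v i)) K x * ev (v i) K x -
        ∑ j, ev ρ K x * ev (v i) K x * ev (D i (v j)) K x * ev (v j) K x := by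
    simp only [ev_divg, D_sum, ev_sum, Finset.mul_sum, Finset.sum_mul, ← Finset.sum_sub_distrib]
    refine Finset.sum_congr rfl fun j _ => ?_
    simp only [D_mul, ev_add, ev_mul]
    ring
  simp only [hskew, Finset.sum_sub_distrib]
  rw [Finset.sum_comm, sub_self]

theorem momentum_dotProduct_velocity (δ : ℝ) (U₀ U₁ : State T) (K : Cell T) (x : E d) :
    let U := mid U₀ U₁
    (∑ i, (ev U.rho K x * ((ev (U₁.vel i) K x - ev (U₀.vel i) K x) / δ)
        + ev (divg (fun j => U.rho * U.vel i * U.vel j)) K x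
        - ev (divg (fun j => U.rho * U.vel j)) K x * ev (U.vel i) K x
        - 1 / 2 * ev U.rho K x * ev (D i (∑ j, U.vel j * U.vel j)) K x
        + ev U.rho K x * ev (D i U.tau) K x
        - ev U.mu K x * ev (D i U.phi) K x) * ev (U.vel i) K x) =
      δ⁻¹ * (ev U.rho K x * (1 / 2 *
          (evVec U₁.vel K x ⬝ᵥ evVec U₁.vel K x - evVec U₀.vel K x ⬝ᵥ evVec U₀.vel K x)))
        + (∑ i, ev (D i U.tau) K x * ev (U.rho * U.vel i) K x
          - ∑ i, ev (D i U.phi) K x * ev (U.mu * U.vel i) K x) := by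
  intro U
  have hkin := sum_sub_mul_ev_midpoint U₀.vel U₁.vel K x
  have hconv := convection_dotProduct_self U.rho U.vel K x
  rw [← hkin, ← add_zero (δ⁻¹ * _), ← hconv, Finset.mul_sum, Finset.mul_sum,
    ← Finset.sum_add_distrib, ← Finset.sum_sub_distrib, ← Finset.sum_add_distrib]
  refine Finset.sum_congr rfl fun i _ => ?_
  rw [show (1 / 2 : ℝ) • (U₀.vel + U₁.vel) = U.vel from rfl, ev_mul, ev_mul]
  ring

end Pointwise

/-! ### The tested equations -/

section TestedEquations

variable {d : ℕ} {Ω : Set (E d)} {T : Triangulation d Ω} {k : ℕ} {P : Params} {δ : ℝ}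
  {U₀ U₁ : State T}

@[fun_prop] theorem continuous_evVec_dotProduct (u v : Fin d → BPoly T) (K : Cell T) :
    Continuous fun x => evVec u K x ⬝ᵥ evVec v K x :=
  (continuous_evVec u K).dotProduct (continuous_evVec v K)

theorem EqRho.volInt_eq (h : EqRho T k δ U₀ U₁) (hδ : δ ≠ 0) {ψ : BPoly T} (hψ : ψ ∈ Vh T k) :
    volInt T (fun K x => ev ψ K x * ev (U₁.rho - U₀.rho) K x) =
      -δ * divForm (fun i => (mid U₀ U₁).rho * (mid U₀ U₁).vel i) ψ := by
  have htest := h ψ hψ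
  simp only [mul_comm (ev ψ _ _)]
  simp only [← ev_sub, div_eq_inv_mul, add_mul, mul_assoc] at htest
  rw [volInt_add, volInt_const_mul, add_sub_assoc, ← divForm] at htest
  · linear_combination (-δ) * htest - volInt T _ * mul_inv_cancel₀ hδ
  all_goals exact brokenIntegrable_of_continuous fun K => by fun_prop

theorem EqPhi.volInt_eq (h : EqPhi T k P δ U₀ U₁) (hδ : δ ≠ 0) (hμ : (mid U₀ U₁).mu ∈ Vh T k)
    (hρ : BrokenIntegrable T fun K x => (ev (mid U₀ U₁).rho K x)⁻¹) :
    volInt T (fun K x => ev (mid U₀ U₁).mu K x * ev (U₁.phi - U₀.phi) K x) =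
      -δ * (gradForm (mid U₀ U₁).phi (fun i => (mid U₀ U₁).mu * (mid U₀ U₁).vel i)
        + volInt T fun K x =>
          P.eta * |ev (mid U₀ U₁).mu K x| ^ 2 / ev (mid U₀ U₁).rho K x) := by
  have htest := h _ hμ
  have hpt (K : Cell T) (x : E d) :
      ((ev U₁.phi K x - ev U₀.phi K x) / δ
          + ∑ i, ev (D i (mid U₀ U₁).phi) K x * ev ((mid U₀ U₁).vel i) K x
          + P.eta * (ev (mid U₀ U₁).mu K x / ev (mid U₀ U₁).rho K x)) * ev (mid U₀ U₁).mu K x =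
        δ⁻¹ * (ev (mid U₀ U₁).mu K x * ev (U₁.phi - U₀.phi) K x)
          + ∑ i, ev (D i (mid U₀ U₁).phi) K x * ev ((mid U₀ U₁).mu * (mid U₀ U₁).vel i) K x
          + P.eta * |ev (mid U₀ U₁).mu K x| ^ 2 / ev (mid U₀ U₁).rho K x := by
    simp only [ev_sub, ev_mul, sq_abs, mul_left_comm _ (ev (mid U₀ U₁).mu K x), ← Finset.mul_sum]
    ring
  have hW : BrokenIntegrable T fun K x =>
      P.eta * |ev (mid U₀ U₁).mu K x| ^ 2 / ev (mid U₀ U₁).rho K x := by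
    simp only [div_eq_inv_mul]
    exact hρ.mul_continuous fun K => by fun_prop
  simp only [hpt] at htest
  rw [volInt_add ?_ hW, volInt_add, volInt_const_mul] at htest
  · rw [gradForm]
    linear_combination (-δ) * htest - volInt T _ * mul_inv_cancel₀ hδ
  all_goals exact brokenIntegrable_of_continuous fun K => by fun_prop

theorem EqVel.volInt_eq [NeZero d] (h : EqVel T k P δ U₀ U₁) (hδ : δ ≠ 0)
    (hv : (mid U₀ U₁).vel ∈ VhZero T k) :
    volInt T (fun K x => ev (mid U₀ U₁).rho K x * (1 / 2 *
        (evVec U₁.vel K x ⬝ᵥ evVec U₁.vel K x - evVec U₀.vel K x ⬝ᵥ evVec U₀.vel K x))) =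
      -δ * (gradForm (mid U₀ U₁).tau (fun i => (mid U₀ U₁).rho * (mid U₀ U₁).vel i)
        - gradForm (mid U₀ U₁).phi (fun i => (mid U₀ U₁).mu * (mid U₀ U₁).vel i)
        + Bh T P (mid U₀ U₁).phi (mid U₀ U₁).vel (mid U₀ U₁).vel) := by
  have htest := h _ hv
  simp only [momentum_dotProduct_velocity] at htest
  rw [volInt_add, volInt_const_mul, volInt_sub, interfaceInt_sub
    (fun _ => continuous_jump_dotProduct_avg _ _) fun _ => continuous_jump_dotProduct_avg _ _]
    at htest
  · rw [gradForm, gradForm]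
    linear_combination (-δ) * htest - volInt T _ * mul_inv_cancel₀ hδ
  all_goals exact brokenIntegrable_of_continuous fun K => by fun_prop

theorem EqMu.volInt_eq (h : EqMu T k P U₀ U₁) (hq : BrokenIntegrable T (dqPhiField P U₀ U₁))
    {χ : BPoly T} (hχ : χ ∈ Vh T k) :
    volInt T (fun K x => ev (mid U₀ U₁).mu K x * ev χ K x) =
      volInt T (fun K x => dqPhiField P U₀ U₁ K x * ev χ K x)
        - P.gamma * divForm (mid U₀ U₁).sig χ := by
  have htest := h χ hχ
  have hqχ := hq.mul_continuous (continuous_ev χ)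
  have hμ : BrokenIntegrable T fun K x => ev (mid U₀ U₁).mu K x * ev χ K x :=
    brokenIntegrable_of_continuous fun K => by fun_prop
  have hσ : BrokenIntegrable T fun K x => P.gamma * (ev (divg (mid U₀ U₁).sig) K x * ev χ K x) :=
    brokenIntegrable_of_continuous fun K => by fun_prop
  simp only [add_mul, sub_mul, mul_assoc, interfaceInt_const_mul] at htest
  rw [volInt_add (hμ.sub hqχ) hσ, volInt_sub hμ hqχ, volInt_const_mul] at htest
  rw [divForm]
  linear_combination -htest

theorem EqTau.volInt_eq (h : EqTau T k P U₀ U₁) (hq : BrokenIntegrable T (dqRhoField P U₀ U₁))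
    {ζ : BPoly T} (hζ : ζ ∈ Vh T k) :
    volInt T (fun K x => ev (mid U₀ U₁).tau K x * ev ζ K x) =
      volInt T (fun K x => dqRhoField P U₀ U₁ K x * ev ζ K x)
        + volInt T (fun K x => 1 / 4 * (evVec U₁.vel K x ⬝ᵥ evVec U₁.vel K x
          + evVec U₀.vel K x ⬝ᵥ evVec U₀.vel K x) * ev ζ K x) := by
  have htest := h ζ hζ
  have hqζ := hq.mul_continuous (continuous_ev ζ)
  have hτ : BrokenIntegrable T fun K x => ev (mid U₀ U₁).tau K x * ev ζ K x :=
    brokenIntegrable_of_continuous fun K => by fun_prop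
  have hv : BrokenIntegrable T fun K x => 1 / 4 * (evVec U₁.vel K x ⬝ᵥ evVec U₁.vel K x
      + evVec U₀.vel K x ⬝ᵥ evVec U₀.vel K x) * ev ζ K x :=
    brokenIntegrable_of_continuous fun K => by fun_prop
  simp only [sub_mul] at htest
  rw [volInt_sub (hτ.sub hqζ) hv, volInt_sub hτ hqζ] at htest
  linear_combination -htest

theorem EqSig.volInt_eq {U : State T} (h : EqSig T k U) {Z : Fin d → BPoly T}
    (hZ : Z ∈ VhNormal T k) :
    volInt T (fun K x => ∑ i, ev (U.sig i) K x * ev (Z i) K x) = gradForm U.phi Z := by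
  have htest := h Z hZ
  simp only [sub_mul, Finset.sum_sub_distrib] at htest
  rw [volInt_sub] at htest
  · rw [gradForm]
    linear_combination -htest
  all_goals exact brokenIntegrable_of_continuous fun K => by fun_prop

theorem volInt_normSq_sig_sub [NeZero d] (h₀ : EqSig T k U₀) (h₁ : EqSig T k U₁)
    (hσ : (mid U₀ U₁).sig ∈ VhNormal T k) :
    volInt T (fun K x => 1 / 2 *
        (evVec U₁.sig K x ⬝ᵥ evVec U₁.sig K x - evVec U₀.sig K x ⬝ᵥ evVec U₀.sig K x)) =
      gradForm (U₁.phi - U₀.phi) (mid U₀ U₁).sig := by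
  rw [gradForm_sub, ← h₁.volInt_eq hσ, ← h₀.volInt_eq hσ, ← volInt_sub]
  · refine congrArg (volInt T) (funext₂ fun K x => ?_)
    rw [← sum_sub_mul_ev_midpoint, ← Finset.sum_sub_distrib]
    exact Finset.sum_congr rfl fun i _ => sub_mul _ _ _
  all_goals exact brokenIntegrable_of_continuous fun K => by fun_prop

end TestedEquations

/-! ### One time step -/

section TimeStep

variable {d : ℕ} {Ω : Set (E d)} {T : Triangulation d Ω} {k : ℕ} {P : Params} {δ : ℝ}
  {U₀ U₁ : State T}

theorem Params.energyDensity_sub (P : Params) (r₀ p₀ s₀ v₀ r₁ p₁ s₁ v₁ : ℝ) :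
    P.dens r₁ p₁ + P.gamma / 2 * s₁ + r₁ / 2 * v₁ -
        (P.dens r₀ p₀ + P.gamma / 2 * s₀ + r₀ / 2 * v₀) =
      P.dqPhi r₀ p₀ r₁ p₁ * (p₁ - p₀) + P.gamma * (1 / 2 * (s₁ - s₀))
        + P.dqRho r₀ p₀ r₁ p₁ * (r₁ - r₀) + 1 / 4 * (v₁ + v₀) * (r₁ - r₀)
        + 1 / 2 * (r₀ + r₁) * (1 / 2 * (v₁ - v₀)) := by
  linear_combination P.dens_sub_dens r₀ p₀ r₁ p₁

theorem energy_sub (hF : BrokenIntegrable T fun K x => P.dens (ev U₀.rho K x) (ev U₀.phi K x))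
    (hφ : BrokenIntegrable T (dqPhiField P U₀ U₁)) (hρ : BrokenIntegrable T (dqRhoField P U₀ U₁)) :
    energy T P U₁ - energy T P U₀ =
      volInt T (fun K x => dqPhiField P U₀ U₁ K x * ev (U₁.phi - U₀.phi) K x)
        + P.gamma * volInt T (fun K x => 1 / 2 *
            (evVec U₁.sig K x ⬝ᵥ evVec U₁.sig K x - evVec U₀.sig K x ⬝ᵥ evVec U₀.sig K x))
        + volInt T (fun K x => dqRhoField P U₀ U₁ K x * ev (U₁.rho - U₀.rho) K x)
        + volInt T (fun K x => 1 / 4 * (evVec U₁.vel K x ⬝ᵥ evVec U₁.vel K x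
            + evVec U₀.vel K x ⬝ᵥ evVec U₀.vel K x) * ev (U₁.rho - U₀.rho) K x)
        + volInt T (fun K x => ev (mid U₀ U₁).rho K x * (1 / 2 *
            (evVec U₁.vel K x ⬝ᵥ evVec U₁.vel K x - evVec U₀.vel K x ⬝ᵥ evVec U₀.vel K x))) := by
  unfold dqPhiField at hφ ⊢
  unfold dqRhoField at hρ ⊢
  have hφ' := hφ.mul_continuous (continuous_ev (U₁.phi - U₀.phi))
  have hρ' := hρ.mul_continuous (continuous_ev (U₁.rho - U₀.rho))
  have hF' : BrokenIntegrable T fun K x => P.dens (ev U₁.rho K x) (ev U₁.phi K x) := by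
    simpa only [ev_sub, ← Params.dens_sub_dens, add_sub_cancel]
      using hF.add (hφ'.add hρ')
  have hmid (K : Cell T) (x : E d) :
      1 / 2 * (ev U₀.rho K x + ev U₁.rho K x) = ev (mid U₀ U₁).rho K x := by
    rw [← ev_add, ← ev_smul]
    rfl
  have hpoly {f : Cell T → E d → ℝ} (hf : ∀ K, Continuous (f K)) : BrokenIntegrable T f :=
    brokenIntegrable_of_continuous hf
  rw [energy, energy, ← volInt_sub]
  · simp only [Params.energyDensity_sub, hmid, ← ev_sub]
    rw [volInt_add, volInt_add, volInt_add, volInt_add, volInt_const_mul]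
    all_goals
      repeat' apply BrokenIntegrable.add
      all_goals first | assumption | exact hpoly fun K => by fun_prop
  · exact (hF'.add (hpoly fun K => by fun_prop)).add (hpoly fun K => by fun_prop)
  · exact (hF.add (hpoly fun K => by fun_prop)).add (hpoly fun K => by fun_prop)

/-- One step `(U₀, U₁)` of length `δ` of the scheme: both states lie in `𝒱_h`, the equations for
`ρ`, `v`, `φ`, `μ`, `τ` hold, `σ₁` is the discrete gradient of `φ₁`, and all the integrands are
integrable. Positivity of the density is relaxed to the midpoint density having no zeros, so that
`μ / ρ` is meaningful. -/
structure IsSchemeStep (T : Triangulation d Ω) (k : ℕ) (P : Params) (δ : ℝ) (U₀ U₁ : State T) :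
    Prop where
  mem₀ : U₀ ∈ StateSpace T k
  mem₁ : U₁ ∈ StateSpace T k
  integrable_dens₀ : BrokenIntegrable T fun K x => P.dens (ev U₀.rho K x) (ev U₀.phi K x)
  integrable_dqPhi : BrokenIntegrable T (dqPhiField P U₀ U₁)
  integrable_dqRho : BrokenIntegrable T (dqRhoField P U₀ U₁)
  integrable_inv_rho : BrokenIntegrable T fun K x => (ev (mid U₀ U₁).rho K x)⁻¹
  rho_ne_zero : ∀ K, ∀ᵐ x ∂volume.restrict (openCell T K), ev (mid U₀ U₁).rho K x ≠ 0
  eq_rho : EqRho T k δ U₀ U₁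
  eq_vel : EqVel T k P δ U₀ U₁
  eq_phi : EqPhi T k P δ U₀ U₁
  eq_mu : EqMu T k P U₀ U₁
  eq_tau : EqTau T k P U₀ U₁
  eq_sig : EqSig T k U₁

namespace IsSchemeStep

variable [NeZero d]

theorem mass_eq (h : IsSchemeStep T k P δ U₀ U₁) (hδ : δ ≠ 0) :
    volInt T (ev U₁.rho) = volInt T (ev U₀.rho) := by
  obtain ⟨-, hv, -⟩ := mid_mem_StateSpace h.mem₀ h.mem₁
  have htest := h.eq_rho.volInt_eq hδ one_mem_Vh
  simp only [ev_one, one_mul, ev_sub] at htest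
  rw [divForm_one ((hasZeroNormalTrace_of_mem_VhZero hv).mul _), mul_zero,
    volInt_sub (brokenIntegrable_of_continuous (continuous_ev _))
      (brokenIntegrable_of_continuous (continuous_ev _))] at htest
  exact sub_eq_zero.1 htest

theorem energy_eq (h : IsSchemeStep T k P δ U₀ U₁) (hδ : δ ≠ 0) (hσ₀ : EqSig T k U₀) :
    energy T P U₁ = energy T P U₀
      - δ * volInt T (fun K x => P.eta * |ev (mid U₀ U₁).mu K x| ^ 2 / ev (mid U₀ U₁).rho K x)
      - δ * Bh T P (mid U₀ U₁).phi (mid U₀ U₁).vel (mid U₀ U₁).vel := by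
  obtain ⟨-, hv, -, hμ, hτ, hσ⟩ := mid_mem_StateSpace h.mem₀ h.mem₁
  have hdφ := sub_mem_Vh h.mem₁.2.2.1 h.mem₀.2.2.1
  have hdρ := sub_mem_Vh h.mem₁.1 h.mem₀.1
  have hgradτ := gradForm_eq_neg_divForm (mid U₀ U₁).tau
    ((hasZeroNormalTrace_of_mem_VhZero hv).mul (mid U₀ U₁).rho)
  have hgradφ := gradForm_eq_neg_divForm (U₁.phi - U₀.phi) (u := (mid U₀ U₁).sig) hσ.2
  have henergy := energy_sub h.integrable_dens₀ h.integrable_dqPhi h.integrable_dqRho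
  have hρ := h.eq_rho.volInt_eq hδ hτ
  have hkin := h.eq_vel.volInt_eq hδ hv
  have hφ := h.eq_phi.volInt_eq hδ hμ h.integrable_inv_rho
  have hμφ := h.eq_mu.volInt_eq h.integrable_dqPhi hdφ
  have hτρ := h.eq_tau.volInt_eq h.integrable_dqRho hdρ
  have hσσ := volInt_normSq_sig_sub hσ₀ h.eq_sig hσ
  linear_combination henergy + hkin + hφ - hμφ + hρ - hτρ + P.gamma * (hσσ + hgradφ) - δ * hgradτ

end IsSchemeStep

end TimeStep

/-! ### Time grids -/

theorem monotoneOn_grid {N : ℕ} {t : ℕ → ℝ} (ht : ∀ n < N, t n < t (n + 1)) :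
    MonotoneOn t (Set.Iic N) :=
  monotoneOn_of_le_succ Set.ordConnected_Iic fun n _ _ hn => (ht n hn).le

theorem exists_mem_Icc_grid {N : ℕ} {t : ℕ → ℝ} {s : ℝ} (hs : s ∈ Set.Icc (t 0) (t N)) :
    s = t 0 ∨ ∃ n < N, s ∈ Set.Icc (t n) (t (n + 1)) := by
  induction N with
  | zero => exact Or.inl (le_antisymm hs.2 hs.1)
  | succ N ih =>
    rcases le_total s (t N) with hsN | hNs
    · exact (ih ⟨hs.1, hsN⟩).imp_right fun ⟨n, hn, hsn⟩ => ⟨n, hn.trans N.lt_succ_self, hsn⟩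
    · exact Or.inr ⟨N, N.lt_succ_self, hNs, hs.2⟩

section Evolution

variable {d : ℕ} {Ω : Set (E d)} {T : Triangulation d Ω} {k : ℕ} {P : Params}
  {N : ℕ} {t : ℕ → ℝ} {U : ℝ → State T}

theorem volInt_rho_interpolation (c : ℝ) (U₀ U₁ : State T) :
    volInt T (ev (c • (U₁ - U₀) + U₀).rho) =
      c * (volInt T (ev U₁.rho) - volInt T (ev U₀.rho)) + volInt T (ev U₀.rho) := by
  have hpoly (p : BPoly T) : BrokenIntegrable T (ev p) :=
    brokenIntegrable_of_continuous (continuous_ev p)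
  have hrho : (c • (U₁ - U₀) + U₀).rho = c • (U₁.rho - U₀.rho) + U₀.rho := rfl
  have hev : ev (c • (U₁.rho - U₀.rho) + U₀.rho) = fun K x =>
      c * (ev U₁.rho K x - ev U₀.rho K x) + ev U₀.rho K x :=
    funext₂ fun K x => by rw [ev_add, ev_smul, ev_sub]
  rw [hrho, hev, volInt_add (((hpoly _).sub (hpoly _)).const_mul c) (hpoly _), volInt_const_mul,
    volInt_sub (hpoly _) (hpoly _)]

theorem volInt_rho_eq_of_steps [NeZero d] (ht : ∀ n < N, t n < t (n + 1))
    (hstep : ∀ n < N, IsSchemeStep T k P (t (n + 1) - t n) (U (t n)) (U (t (n + 1))))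
    (hU : ∀ n < N, ∀ s ∈ Set.Icc (t n) (t (n + 1)),
      U s = ((s - t n) / (t (n + 1) - t n)) • (U (t (n + 1)) - U (t n)) + U (t n))
    {s : ℝ} (hs : s ∈ Set.Icc (t 0) (t N)) :
    volInt T (ev (U s).rho) = volInt T (ev (U (t 0)).rho) := by
  have hmass (n : ℕ) (hn : n < N) :
      volInt T (ev (U (t (n + 1))).rho) = volInt T (ev (U (t n)).rho) :=
    (hstep n hn).mass_eq (sub_ne_zero.2 (ht n hn).ne')
  have hgrid (n : ℕ) (hn : n ≤ N) : volInt T (ev (U (t n)).rho) = volInt T (ev (U (t 0)).rho) := by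
    induction n with
    | zero => rfl
    | succ n ih => exact (hmass n hn).trans (ih (Nat.le_of_succ_le hn))
  rcases exists_mem_Icc_grid hs with rfl | ⟨n, hn, hsn⟩
  · rfl
  · rw [hU n hn s hsn, volInt_rho_interpolation, hmass n hn, sub_self, mul_zero, zero_add,
      hgrid n hn.le]

theorem IsFullyDiscrete.mid_eq {Uinit : InitialData Ω} (ht : ∀ n < N, t n < t (n + 1))
    (hU : IsFullyDiscrete T k P Uinit N t U) {n : ℕ} (hn : n < N) :
    mid (U (t n)) (U (t (n + 1))) = U ((t n + t (n + 1)) / 2) := by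
  have hlt := ht n hn
  have hhalf : ((t n + t (n + 1)) / 2 - t n) / (t (n + 1) - t n) = 1 / 2 := by
    rw [div_eq_iff (sub_ne_zero.2 hlt.ne')]
    ring
  rw [hU.interpolates n hn ((t n + t (n + 1)) / 2) ⟨by linarith, by linarith⟩, hhalf, mid]
  module

theorem IsFullyDiscrete.isSchemeStep {Uinit : InitialData Ω} (ht0 : t 0 = 0)
    (ht : ∀ n < N, t n < t (n + 1)) (hU : IsFullyDiscrete T k P Uinit N t U) {n : ℕ} (hn : n < N) :
    IsSchemeStep T k P (t (n + 1) - t n) (U (t n)) (U (t (n + 1))) := by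
  have hgrid {m : ℕ} (hm : m ≤ N) : t m ∈ Set.Icc 0 (t N) :=
    ⟨ht0 ▸ monotoneOn_grid ht N.zero_le hm m.zero_le,
      monotoneOn_grid ht hm (Set.mem_Iic.2 le_rfl) hm⟩
  have hmid : (t n + t (n + 1)) / 2 ∈ Set.Icc 0 (t N) := by
    have h₀ := hgrid hn.le
    have h₁ := hgrid hn
    constructor <;> linarith [h₀.1, h₀.2, h₁.1, h₁.2]
  exact
    { mem₀ := hU.mem _ (hgrid hn.le)
      mem₁ := hU.mem _ (hgrid hn)
      integrable_dens₀ := brokenIntegrable_of_memLp_two fun K => (hU.dens K).1 _ (hgrid hn.le)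
      integrable_dqPhi := fun K => (hU.integrable n hn K).1
      integrable_dqRho := fun K => (hU.integrable n hn K).2
      integrable_inv_rho := by
        rw [hU.mid_eq ht hn]
        exact brokenIntegrable_of_memLp_two fun K => (hU.inv_rho K).1 _ hmid
      rho_ne_zero := fun K => by
        rw [hU.mid_eq ht hn]
        exact (hU.bounds _ hmid K).mono fun x hx => hx.1.ne'
      eq_rho := hU.eq_rho n hn
      eq_vel := hU.eq_vel n hn
      eq_phi := hU.eq_phi n hn
      eq_mu := hU.eq_mu n hn
      eq_tau := hU.eq_tau n hn
      eq_sig := hU.eq_sig n hn }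

theorem InitialData.integrableOn_rho (T : Triangulation d Ω) (Uinit : InitialData Ω) :
    IntegrableOn Uinit.rho Ω :=
  have : IsFiniteMeasure (volume.restrict Ω) := isFiniteMeasure_restrict.2
    ((measure_mono subset_closure).trans_lt (isCompact_closure_domain T).measure_lt_top).ne
  Uinit.rho_mem.integrable one_le_two

end Evolution

theorem mainTheorem4_general {d : ℕ} [NeZero d] {Ω : Set (E d)}
    (hΩ : interior (closure Ω) = Ω) (T : Triangulation d Ω) (k : ℕ) (P : Params)
    {f : E d → ℝ} (hf : IntegrableOn f Ω) (N : ℕ) (t : ℕ → ℝ) (ht : ∀ n < N, t n < t (n + 1))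
    (U : ℝ → State T) (hinit : IsProjScalar T k f (U (t 0)).rho)
    (hU : ∀ n < N, ∀ s ∈ Set.Icc (t n) (t (n + 1)),
      U s = ((s - t n) / (t (n + 1) - t n)) • (U (t (n + 1)) - U (t n)) + U (t n))
    (hstep : ∀ n < N, IsSchemeStep T k P (t (n + 1) - t n) (U (t n)) (U (t (n + 1)))) :
    (∀ s ∈ Set.Icc (t 0) (t N), volInt T (ev (U s).rho) = ∫ x in Ω, f x) ∧
    (∀ n < N, (n = 0 → EqSig T k (U (t 0))) →
      energy T P (U (t (n + 1))) = energy T P (U (t n))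
        - (t (n + 1) - t n) * volInt T (fun K x =>
            P.eta * |ev (mid (U (t n)) (U (t (n + 1)))).mu K x| ^ 2
              / ev (mid (U (t n)) (U (t (n + 1)))).rho K x)
        - (t (n + 1) - t n) * Bh T P (mid (U (t n)) (U (t (n + 1)))).phi
            (mid (U (t n)) (U (t (n + 1)))).vel (mid (U (t n)) (U (t (n + 1)))).vel) := by
  refine ⟨fun s hs => ?_, fun n hn hσ₀ => ?_⟩
  · rw [volInt_rho_eq_of_steps ht hstep hU hs, hinit.volInt_eq hΩ hf]
  · refine (hstep n hn).energy_eq (sub_ne_zero.2 (ht n hn).ne') ?_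
    obtain _ | n := n
    · exact hσ₀ rfl
    · exact (hstep n (Nat.lt_of_succ_lt hn)).eq_sig

end NSAC

end

theorem mainTheorem4 {d : ℕ} (hd : 0 < d) {Ω : Set (NSAC.E d)}
    (hΩ : interior (closure Ω) = Ω) (T : NSAC.Triangulation d Ω) (k : ℕ)
    (P : NSAC.Params) (Uinit : NSAC.InitialData Ω)
    (N : ℕ) (t : ℕ → ℝ) (ht0 : t 0 = 0) (ht : ∀ n < N, t n < t (n + 1))
    (U : ℝ → NSAC.State T) (hU : NSAC.IsFullyDiscrete T k P Uinit N t U) :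
    (∀ s ∈ Set.Icc 0 (t N),
      NSAC.volInt T (fun K x => NSAC.ev (U s).rho K x) = ∫ x in Ω, Uinit.rho x) ∧
    (∀ n < N, (n = 0 → NSAC.EqSig T k (U 0)) →
      NSAC.energy T P (U (t (n + 1))) ≤ NSAC.energy T P (U (t n))
        - (t (n + 1) - t n) * NSAC.volInt T (fun K x =>
            P.eta * |NSAC.ev (NSAC.mid (U (t n)) (U (t (n + 1)))).mu K x| ^ 2
              / NSAC.ev (NSAC.mid (U (t n)) (U (t (n + 1)))).rho K x)
        - (t (n + 1) - t n) * NSAC.Bh T P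
            (NSAC.mid (U (t n)) (U (t (n + 1)))).phi
            (NSAC.mid (U (t n)) (U (t (n + 1)))).vel
            (NSAC.mid (U (t n)) (U (t (n + 1)))).vel) := by
  have : NeZero d := ⟨hd.ne'⟩
  obtain ⟨hmass, henergy⟩ := NSAC.mainTheorem4_general hΩ T k P (Uinit.integrableOn_rho T) N t ht U
    (ht0 ▸ hU.init.2.1) hU.interpolates fun n hn => hU.isSchemeStep ht0 ht hn
  rw [ht0] at hmass henergy
  exact ⟨hmass, fun n hn hσ₀ => (henergy n hn hσ₀).le⟩
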